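/- An instance $I=(G,N,\mathcal U)$ of connected fair division consists of an undirected graph $G=(V,E)$ whose vertices are the items, a set of players $N=\{1,\dots,n\}$, and utility functions $u_i:V\to\mathbb{Q}_{\ge 0}$ with $\sum_{v\in V}u_i(v)=1$ for each $i\in N$; for $X\subseteq V$ put $u_i(X)=\sum_{v\in X}u_i(v)$. An allocation $\pi:N\to 2^V$ is valid if every bundle $\pi(i)$ is connected in $G$ (the empty bundle is allowed) and $\pi(i)\cap\pi(j)=\emptyset$ for all $i\ne j$; it is proportional if $u_i(\pi(i))\ge \frac1n$ for all $i\in N$. The problem Prop-CFD asks whether a given instance admits a proportional valid allocation. Write $|I|$ for the length of the encoding of $I$ in which the graph is given by its adjacency matrix and the numerators and denominators of the utilities are written in binary. **Theorem.** Prop-CFD restricted to instances in which $G$ is a tree is fixed-parameter tractable with respect to the number of players $n$: there are a single algorithm (a random access machine program, with running time measured by logarithmic cost), a function $f:\mathbb N\to\mathbb N$ and a polynomial $q$ such that for every instance $I$ with $n$ players whose graph is a tree, the algorithm halts after time at most $f(n)\cdot q(|I|)$ and answers correctly whether $I$ admits a proportional valid allocation. -/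

import Mathlib

/-! ### Connected fair division -/

/-- An instance of connected fair division with rational utilities: the items are the vertices
`Fin m` of a graph, the players are `Fin n`. -/
structure CFD where
  n : ℕ
  m : ℕ
  graph : SimpleGraph (Fin m)
  util : Fin n → Fin m → ℚ
  util_nonneg : ∀ i v, 0 ≤ util i v
  util_sum : ∀ i, ∑ v, util i v = 1

namespace CFD

/-- Additive utility of a bundle. -/
def bundleUtil (I : CFD) (i : Fin I.n) (X : Finset (Fin I.m)) : ℚ :=
  ∑ v ∈ X, I.util i v

/-- Every bundle is connected (possibly empty) and no item is allocated twice. -/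
def Valid (I : CFD) (π : Fin I.n → Finset (Fin I.m)) : Prop :=
  (∀ i, (I.graph.induce (π i : Set (Fin I.m))).Preconnected) ∧
    ∀ i j, i ≠ j → Disjoint (π i) (π j)

def Proportional (I : CFD) (π : Fin I.n → Finset (Fin I.m)) : Prop :=
  ∀ i, (1 : ℚ) / (I.n : ℚ) ≤ I.bundleUtil i (π i)

/-- The question of Prop-CFD: is there a proportional valid allocation? -/
def HasPropAllocation (I : CFD) : Prop :=
  ∃ π : Fin I.n → Finset (Fin I.m), I.Valid π ∧ I.Proportional π

open Classical in
/-- The input word: `n`, `m`, the adjacency matrix row by row, and then, player by player and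
item by item, numerator and denominator of the utility in lowest terms. -/
noncomputable def encode (I : CFD) : List ℕ :=
  [I.n, I.m] ++
    ((List.finRange I.m).flatMap fun v =>
      (List.finRange I.m).map fun w => if I.graph.Adj v w then 1 else 0) ++
    ((List.finRange I.n).flatMap fun i =>
      (List.finRange I.m).flatMap fun v => [(I.util i v).num.toNat, (I.util i v).den])

end CFD

/-! ### Random access machines with logarithmic cost -/

namespace RAM

/-- Programs of a random access machine, in structured form. A cell index written in the program
is a direct address; `load` and `store` use indirect addresses. -/
inductive Prog : Type
  | skip
  | const (r c : ℕ)
  | copy (r a : ℕ)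
  | add (r a b : ℕ)
  | sub (r a b : ℕ)
  | mul (r a b : ℕ)
  | div (r a b : ℕ)
  | load (r a : ℕ)
  | store (a b : ℕ)
  | read (r : ℕ)
  | seq (p q : Prog)
  | ite (a : ℕ) (p q : Prog)
  | while (a : ℕ) (p : Prog)

/-- The memory, and the part of the input tape that has not been read yet. -/
structure State where
  mem : ℕ → ℕ
  input : List ℕ

/-- Assignment of a value to a memory cell. -/
def State.set (s : State) (r x : ℕ) : State :=
  { s with mem := Function.update s.mem r x }

/-- Initially all cells are zero and the whole input is on the tape. -/
def start (w : List ℕ) : State where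
  mem := fun _ => 0
  input := w

/-- Logarithmic cost of a natural number: its number of binary digits, plus one. -/
def lc (x : ℕ) : ℕ := Nat.size x + 1

/-- Cost of using the cell `a` as an operand: its address and its content. -/
def State.opCost (s : State) (a : ℕ) : ℕ := lc a + lc (s.mem a)

/-- `Exec p s t s'`: started in the state `s`, the program `p` halts in the state `s'`, and the
total logarithmic cost of the run is `t`. -/
inductive Exec : Prog → State → ℕ → State → Prop
  | skip (s : State) : Exec .skip s 1 s
  | const (r c : ℕ) (s : State) :
      Exec (.const r c) s (lc r + lc c) (s.set r c)
  | copy (r a : ℕ) (s : State) :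
      Exec (.copy r a) s (lc r + s.opCost a) (s.set r (s.mem a))
  | add (r a b : ℕ) (s : State) :
      Exec (.add r a b) s (lc r + s.opCost a + s.opCost b) (s.set r (s.mem a + s.mem b))
  /-- truncated subtraction -/
  | sub (r a b : ℕ) (s : State) :
      Exec (.sub r a b) s (lc r + s.opCost a + s.opCost b) (s.set r (s.mem a - s.mem b))
  | mul (r a b : ℕ) (s : State) :
      Exec (.mul r a b) s (lc r + s.opCost a + s.opCost b) (s.set r (s.mem a * s.mem b))
  /-- integer division, with value `0` if the divisor is `0` -/
  | div (r a b : ℕ) (s : State) :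
      Exec (.div r a b) s (lc r + s.opCost a + s.opCost b) (s.set r (s.mem a / s.mem b))
  /-- the content of the cell whose address is in the cell `a` is copied to the cell `r` -/
  | load (r a : ℕ) (s : State) :
      Exec (.load r a) s (lc r + lc a + s.opCost (s.mem a)) (s.set r (s.mem (s.mem a)))
  /-- the content of the cell `b` is copied to the cell whose address is in the cell `a` -/
  | store (a b : ℕ) (s : State) :
      Exec (.store a b) s (s.opCost a + s.opCost b) (s.set (s.mem a) (s.mem b))
  /-- the next number on the input tape is read; past the end of the input it is `0` -/
  | read (r : ℕ) (s : State) :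
      Exec (.read r) s (lc r + lc (s.input.headD 0))
        { s.set r (s.input.headD 0) with input := s.input.tail }
  | seq {p q : Prog} {s s' s'' : State} {t t' : ℕ} :
      Exec p s t s' → Exec q s' t' s'' → Exec (.seq p q) s (t + t') s''
  | ite_true {a : ℕ} {p q : Prog} {s s' : State} {t : ℕ} :
      s.mem a ≠ 0 → Exec p s t s' → Exec (.ite a p q) s (s.opCost a + t) s'
  | ite_false {a : ℕ} {p q : Prog} {s s' : State} {t : ℕ} :
      s.mem a = 0 → Exec q s t s' → Exec (.ite a p q) s (s.opCost a + t) s'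
  | while_true {a : ℕ} {p : Prog} {s s' s'' : State} {t t' : ℕ} :
      s.mem a ≠ 0 → Exec p s t s' → Exec (.while a p) s' t' s'' →
      Exec (.while a p) s (s.opCost a + t + t') s''
  | while_false {a : ℕ} {p : Prog} {s : State} :
      s.mem a = 0 → Exec (.while a p) s (s.opCost a) s

/-- Size of an input word: the total logarithmic cost of its entries. -/
def inputSize (w : List ℕ) : ℕ := (w.map lc).sum

/-- The run of a program from a given state is unique. -/
theorem Exec.unique {p : Prog} {s s₁ s₂ : State} {t₁ t₂ : ℕ}
    (h₁ : Exec p s t₁ s₁) (h₂ : Exec p s t₂ s₂) : t₁ = t₂ ∧ s₁ = s₂ := by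
  induction h₁ generalizing t₂ s₂ with
  | seq _ _ ih ih' =>
    cases h₂ with
    | seq h h' =>
      obtain ⟨rfl, rfl⟩ := ih h
      obtain ⟨rfl, rfl⟩ := ih' h'
      exact ⟨rfl, rfl⟩
  | ite_true ha _ ih =>
    cases h₂ with
    | ite_true _ h =>
      obtain ⟨rfl, rfl⟩ := ih h
      exact ⟨rfl, rfl⟩
    | ite_false hb _ => exact absurd hb ha
  | ite_false ha _ ih =>
    cases h₂ with
    | ite_true hb _ => exact absurd ha hb
    | ite_false _ h =>
      obtain ⟨rfl, rfl⟩ := ih h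
      exact ⟨rfl, rfl⟩
  | while_true ha _ _ ih ih' =>
    cases h₂ with
    | while_true _ h h' =>
      obtain ⟨rfl, rfl⟩ := ih h
      obtain ⟨rfl, rfl⟩ := ih' h'
      exact ⟨rfl, rfl⟩
    | while_false hb => exact absurd hb ha
  | while_false ha =>
    cases h₂ with
    | while_true hb _ _ => exact absurd ha hb
    | while_false _ => exact ⟨rfl, rfl⟩
  | _ => cases h₂; exact ⟨rfl, rfl⟩

/-- The decision problem with instances `{a // D a}`, encoding `enc` and question `yes` is
fixed-parameter tractable with respect to the parameter `k`: one program decides every instance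
`a` in time `f (k a) * p (|a|)` for a function `f` and a polynomial `p`. The answer is left in
cell `0`: `1` for yes and `0` for no. -/
def IsFPT {α : Type} (D : α → Prop) (enc : α → List ℕ) (k : α → ℕ) (yes : α → Prop) : Prop :=
  ∃ (P : Prog) (f : ℕ → ℕ) (p : Polynomial ℕ), ∀ a : α, D a →
    ∃ (t : ℕ) (s : State), Exec P (start (enc a)) t s ∧
      t ≤ f (k a) * p.eval (inputSize (enc a)) ∧
      (yes a → s.mem 0 = 1) ∧ (¬ yes a → s.mem 0 = 0)

end RAM

/-! Combinatorial half. Multiplying every utility by the number of players and by the product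
`commonDen` of all denominators gives natural weights, and proportionality becomes weight at least
`D` with `D = commonDen` (`proportional_iff`). The tree is then consumed by eliminating leaves.
Every surviving vertex `v` represents a blob `B v` of vertices already absorbed, and no other vertex
of the blob has neighbours outside it (`IsBlobs`). For each blob, each set of players coded by `S`
and each player `i`, a table records the greatest weight for `i` of a connected bundle in `B v`
through `v` that leaves enough of the blob to serve `S`.

When a leaf `c` is absorbed by its neighbour `p`, the two blobs are joined by the single edge `p c`.
Only the bundle containing `p` can cross it, so every other served player is served entirely on one
side, and the crossing bundle splits into a part through `p` and a part that either contains `c` or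
is empty (`extends_union_iff`). The new table is therefore a maximum over pairs of codes of disjoint
sets (`IsTable.merge`). A dummy player `n`, to whom every item is worth `D`, holds the vertex when
no real player does, so that serving `S` in a blob can also be read from its table
(`serves_iff_exists_extends`). After all but one vertex have been eliminated, the last blob is the
whole tree and its table answers the question. A table has `2 ^ n * (n + 1)` entries, and a merge
inspects at most `4 ^ n` pairs of codes for each of them.

Machine half. The algorithm is written in a small language of bounded loops and compiled to machine
code. The notion `Runs` charges each instruction by how much it can enlarge the numbers in memory;
logarithmic time is then at most quadratic in the charge and the initial sizes. If all loop bounds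
and all sizes of second factors and of numbers read are at most `M`, the charge is a fixed
polynomial in `M` (`Stmt.runs_compile`). Here `M` can be taken as a function of `n` times a
polynomial in the input size (`TreeSolver.enough`), and `TreeSolver.eval_mul_le` pulls the factor
depending on `n` out of the polynomial. -/

namespace RAM

/-! ### Charged runs

A charged run counts one unit per instruction; reading and multiplying are also charged for the
size of the number read, respectively of the second factor. The charge bounds how much the sizes
of the numbers in memory can grow, and hence the logarithmic cost. -/

/-- The total size of the numbers written in a program. -/
def Prog.statics : Prog → ℕ
  | .skip => 0
  | .const r c => r.size + c.size
  | .copy r a => r.size + a.size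
  | .add r a b => r.size + a.size + b.size
  | .sub r a b => r.size + a.size + b.size
  | .mul r a b => r.size + a.size + b.size
  | .div r a b => r.size + a.size + b.size
  | .load r a => r.size + a.size
  | .store a b => a.size + b.size
  | .read r => r.size
  | .seq p q => p.statics + q.statics
  | .ite a p q => a.size + p.statics + q.statics
  | .while a p => a.size + p.statics

/-- The program `p` leads from `σ` to `σ'` with charge at most `K`. -/
def Runs (p : Prog) (σ : State) (K : ℕ) (σ' : State) : Prop :=
  ∀ B, p.statics ≤ B → (∀ x, (σ.mem x).size ≤ B) →
    ∃ t, Exec p σ t σ' ∧ t ≤ 6 * K * (B + K + 1) ∧ ∀ x, (σ'.mem x).size ≤ B + K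

theorem size_set_le {σ : State} {B K r x : ℕ} (h : ∀ y, (σ.mem y).size ≤ B)
    (hx : x.size ≤ B + K) (y : ℕ) : ((σ.set r x).mem y).size ≤ B + K := by
  simp only [State.set, Function.update_apply]
  split
  · exact hx
  · exact (h y).trans (Nat.le_add_right _ _)

theorem size_add_le {a b B : ℕ} (ha : a.size ≤ B) (hb : b.size ≤ B) :
    (a + b).size ≤ B + 1 := by
  rw [Nat.size_le] at *
  rw [pow_succ]
  omega

theorem size_mul_le (a b : ℕ) : (a * b).size ≤ a.size + b.size := by
  rw [Nat.size_le, pow_add]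
  exact Nat.mul_lt_mul'' (Nat.lt_size_self a) (Nat.lt_size_self b)

theorem size_le_self (a : ℕ) : a.size ≤ a := Nat.size_le.2 Nat.lt_two_pow_self

theorem Runs.mono {p : Prog} {σ σ' : State} {K K' : ℕ} (h : Runs p σ K σ') (hK : K ≤ K') :
    Runs p σ K' σ' := by
  intro B hB hσ
  obtain ⟨t, ht, hc, hs⟩ := h B hB hσ
  exact ⟨t, ht, hc.trans (by gcongr), fun x => (hs x).trans (by omega)⟩

theorem runs_const (r c : ℕ) (σ : State) : Runs (.const r c) σ 1 (σ.set r c) := by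
  intro B hB hσ
  simp only [Prog.statics] at hB
  refine ⟨_, .const r c σ, ?_, size_set_le hσ (by omega)⟩
  simp only [lc]; omega

theorem runs_copy (r a : ℕ) (σ : State) : Runs (.copy r a) σ 1 (σ.set r (σ.mem a)) := by
  intro B hB hσ
  simp only [Prog.statics] at hB
  have := hσ a
  refine ⟨_, .copy r a σ, ?_, size_set_le hσ (by omega)⟩
  simp only [lc, State.opCost]; omega

theorem runs_add (r a b : ℕ) (σ : State) :
    Runs (.add r a b) σ 1 (σ.set r (σ.mem a + σ.mem b)) := by
  intro B hB hσ
  simp only [Prog.statics] at hB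
  have ha := hσ a
  have hb := hσ b
  refine ⟨_, .add r a b σ, ?_, size_set_le hσ (size_add_le ha hb)⟩
  simp only [lc, State.opCost]; omega

theorem runs_sub (r a b : ℕ) (σ : State) :
    Runs (.sub r a b) σ 1 (σ.set r (σ.mem a - σ.mem b)) := by
  intro B hB hσ
  simp only [Prog.statics] at hB
  have ha := hσ a
  have hb := hσ b
  have := Nat.size_le_size (Nat.sub_le (σ.mem a) (σ.mem b))
  refine ⟨_, .sub r a b σ, ?_, size_set_le hσ (by omega)⟩
  simp only [lc, State.opCost]; omega

theorem runs_div (r a b : ℕ) (σ : State) :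
    Runs (.div r a b) σ 1 (σ.set r (σ.mem a / σ.mem b)) := by
  intro B hB hσ
  simp only [Prog.statics] at hB
  have ha := hσ a
  have hb := hσ b
  have := Nat.size_le_size (Nat.div_le_self (σ.mem a) (σ.mem b))
  refine ⟨_, .div r a b σ, ?_, size_set_le hσ (by omega)⟩
  simp only [lc, State.opCost]; omega

/-- The first factor may be as long as any number in memory, and it accounts for `B`; only the
second factor adds new digits. A product of many short numbers, accumulated in the first factor,
thus stays cheap. -/
theorem runs_mul (r a b : ℕ) (σ : State) :
    Runs (.mul r a b) σ (1 + (σ.mem b).size) (σ.set r (σ.mem a * σ.mem b)) := by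
  intro B hB hσ
  simp only [Prog.statics] at hB
  have ha := hσ a
  have hb := hσ b
  have := size_mul_le (σ.mem a) (σ.mem b)
  refine ⟨_, .mul r a b σ, ?_, size_set_le hσ (by omega)⟩
  simp only [lc, State.opCost]
  nlinarith

theorem runs_load (r a : ℕ) (σ : State) :
    Runs (.load r a) σ 1 (σ.set r (σ.mem (σ.mem a))) := by
  intro B hB hσ
  simp only [Prog.statics] at hB
  have ha := hσ a
  have hb := hσ (σ.mem a)
  refine ⟨_, .load r a σ, ?_, size_set_le hσ (by omega)⟩
  simp only [lc, State.opCost]; omega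

theorem runs_store (a b : ℕ) (σ : State) :
    Runs (.store a b) σ 1 (σ.set (σ.mem a) (σ.mem b)) := by
  intro B hB hσ
  simp only [Prog.statics] at hB
  have ha := hσ a
  have hb := hσ b
  refine ⟨_, .store a b σ, ?_, size_set_le hσ (by omega)⟩
  simp only [lc, State.opCost]; omega

theorem runs_read (r : ℕ) (σ : State) :
    Runs (.read r) σ (1 + (σ.input.headD 0).size)
      { σ.set r (σ.input.headD 0) with input := σ.input.tail } := by
  intro B hB hσ
  simp only [Prog.statics] at hB
  refine ⟨_, .read r σ, ?_, size_set_le hσ (by omega)⟩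
  simp only [lc]
  nlinarith

/-- The first run may raise the sizes from `B` to `B + K`, so the second is used with the bound `B +
K`; this is why `Runs` quantifies over all `B`. Both time bounds are then dominated by the one for
`K + K'`. -/
theorem Runs.seq {p q : Prog} {σ σ' σ'' : State} {K K' : ℕ} (h : Runs p σ K σ')
    (h' : Runs q σ' K' σ'') : Runs (.seq p q) σ (K + K') σ'' := by
  intro B hB hσ
  simp only [Prog.statics] at hB
  obtain ⟨t, ht, hc, hs⟩ := h B (by omega) hσ
  obtain ⟨t', ht', hc', hs'⟩ := h' (B + K) (by omega) hs
  refine ⟨_, .seq ht ht', ?_, fun x => (hs' x).trans (by omega)⟩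
  nlinarith

theorem Runs.ite_true {a : ℕ} {p : Prog} (q : Prog) {σ σ' : State} {K : ℕ} (ha : σ.mem a ≠ 0)
    (h : Runs p σ K σ') : Runs (.ite a p q) σ (1 + K) σ' := by
  intro B hB hσ
  simp only [Prog.statics] at hB
  obtain ⟨t, ht, hc, hs⟩ := h B (by omega) hσ
  have := hσ a
  refine ⟨_, .ite_true ha ht, ?_, fun x => (hs x).trans (by omega)⟩
  simp only [lc, State.opCost]
  nlinarith

theorem Runs.ite_false {a : ℕ} (p : Prog) {q : Prog} {σ σ' : State} {K : ℕ} (ha : σ.mem a = 0)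
    (h : Runs q σ K σ') : Runs (.ite a p q) σ (1 + K) σ' := by
  intro B hB hσ
  simp only [Prog.statics] at hB
  obtain ⟨t, ht, hc, hs⟩ := h B (by omega) hσ
  have := hσ a
  refine ⟨_, .ite_false ha ht, ?_, fun x => (hs x).trans (by omega)⟩
  simp only [lc, State.opCost]
  nlinarith

theorem runs_while_false {a : ℕ} (p : Prog) {σ : State} (ha : σ.mem a = 0) :
    Runs (.while a p) σ 1 σ := by
  intro B hB hσ
  simp only [Prog.statics] at hB
  have := hσ a
  refine ⟨_, .while_false ha, ?_, fun x => (hσ x).trans (by omega)⟩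
  simp only [lc, State.opCost]
  omega

theorem Runs.while_true {a : ℕ} {p : Prog} {σ σ' σ'' : State} {K K' : ℕ} (ha : σ.mem a ≠ 0)
    (h : Runs p σ K σ') (h' : Runs (.while a p) σ' K' σ'') :
    Runs (.while a p) σ (1 + K + K') σ'' := by
  intro B hB hσ
  have hB' := hB
  simp only [Prog.statics] at hB
  obtain ⟨t, ht, hc, hs⟩ := h B (by omega) hσ
  obtain ⟨t', ht', hc', hs'⟩ := h' (B + K) (by omega) hs
  have := hσ a
  refine ⟨_, .while_true ha ht ht', ?_, fun x => (hs' x).trans (by omega)⟩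
  simp only [lc, State.opCost]
  nlinarith

/-! ### A language with expressions, arrays and bounded loops -/

/-- Iteration of an indexed step. -/
def iter {α : Type*} (f : ℕ → α → α) : ℕ → α → α
  | 0, x => x
  | n + 1, x => f n (iter f n x)

/-- Scalar variables, arrays and the rest of the input. -/
structure Env where
  v : ℕ → ℕ
  a : Fin 14 → ℕ → ℕ
  inp : List ℕ

namespace Env

def setv (s : Env) (x y : ℕ) : Env := { s with v := Function.update s.v x y }

def seta (s : Env) (k : Fin 14) (g : ℕ → ℕ) : Env := { s with a := Function.update s.a k g }

/-- Read the next input number into the variable `x`. -/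
def pop (s : Env) (x : ℕ) : Env := { s.setv x (s.inp.headD 0) with inp := s.inp.tail }

/-- Layout of variables, auxiliary registers `τ` and arrays in the memory of a machine. -/
def ram (s : Env) (τ : ℕ → ℕ) : State where
  mem x :=
    if x % 16 = 0 then s.v (x / 16)
    else if x % 16 = 1 then τ (x / 16)
    else s.a ⟨x % 16 - 2, by omega⟩ (x / 16)
  input := s.inp

variable (s : Env) (τ : ℕ → ℕ)

@[simp] theorem setv_v (x y : ℕ) : (s.setv x y).v = Function.update s.v x y := rfl
@[simp] theorem setv_a (x y : ℕ) : (s.setv x y).a = s.a := rfl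
@[simp] theorem setv_inp (x y : ℕ) : (s.setv x y).inp = s.inp := rfl
@[simp] theorem seta_v (k : Fin 14) (g : ℕ → ℕ) : (s.seta k g).v = s.v := rfl
@[simp] theorem seta_a (k : Fin 14) (g : ℕ → ℕ) :
    (s.seta k g).a = Function.update s.a k g := rfl
@[simp] theorem seta_inp (k : Fin 14) (g : ℕ → ℕ) : (s.seta k g).inp = s.inp := rfl

@[simp] theorem pop_v (x : ℕ) : (s.pop x).v = Function.update s.v x (s.inp.headD 0) := rfl
@[simp] theorem pop_a (x : ℕ) : (s.pop x).a = s.a := rfl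
@[simp] theorem pop_inp (x : ℕ) : (s.pop x).inp = s.inp.tail := rfl

@[simp] theorem setv_setv (x y z : ℕ) : (s.setv x y).setv x z = s.setv x z := by
  simp [setv]

@[simp] theorem seta_seta (k : Fin 14) (g h : ℕ → ℕ) :
    (s.seta k g).seta k h = s.seta k h := by
  simp [seta]

theorem setv_seta (x y : ℕ) (k : Fin 14) (g : ℕ → ℕ) :
    (s.setv x y).seta k g = (s.seta k g).setv x y := rfl

@[simp] theorem setv_self (x : ℕ) : s.setv x (s.v x) = s := by simp [setv]

@[simp] theorem seta_self (k : Fin 14) : s.seta k (s.a k) = s := by simp [seta]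

theorem setv_comm {x y : ℕ} (h : x ≠ y) (b c : ℕ) :
    (s.setv x b).setv y c = (s.setv y c).setv x b := by
  simp [setv, Function.update_comm h]

@[simp] theorem ram_input : (s.ram τ).input = s.inp := rfl

@[simp] theorem ram_mem_var (x : ℕ) : (s.ram τ).mem (16 * x) = s.v x := by
  simp [ram]

@[simp] theorem ram_mem_aux (t : ℕ) : (s.ram τ).mem (16 * t + 1) = τ t := by
  have h : (16 * t + 1) % 16 = 1 := by omega
  have h' : (16 * t + 1) / 16 = t := by omega
  simp [ram, h, h']

theorem ram_mem_arr (k : Fin 14) (j : ℕ) : (s.ram τ).mem (j * 16 + (k + 2)) = s.a k j := by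
  have h : (j * 16 + (k + 2)) % 16 = k + 2 := by omega
  have h' : (j * 16 + ((k : ℕ) + 2)) / 16 = j := by omega
  simp [ram, h, h']

@[simp] theorem ram_set_var (x y : ℕ) : (s.ram τ).set (16 * x) y = (s.setv x y).ram τ := by
  simp only [ram, State.set, setv, State.mk.injEq, and_true]
  funext z
  simp only [Function.update_apply]
  by_cases h : z = 16 * x
  · subst h; simp
  · have h' : z % 16 = 0 → z / 16 ≠ x := by omega
    by_cases h0 : z % 16 = 0
    · simp [h, h0, h' h0]
    · simp [h, h0]

@[simp] theorem ram_set_aux (t y : ℕ) :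
    (s.ram τ).set (16 * t + 1) y = s.ram (Function.update τ t y) := by
  simp only [ram, State.set, State.mk.injEq, and_true]
  funext z
  simp only [Function.update_apply]
  by_cases h : z = 16 * t + 1
  · subst h
    have h : (16 * t + 1) % 16 = 1 := by omega
    have h' : (16 * t + 1) / 16 = t := by omega
    simp [h, h']
  · have h' : z % 16 = 1 → z / 16 ≠ t := by omega
    by_cases h0 : z % 16 = 1
    · simp [h, h0, h' h0]
    · simp [h, h0]

theorem ram_set_arr (k : Fin 14) (j y : ℕ) :
    (s.ram τ).set (j * 16 + (k + 2)) y = (s.seta k (Function.update (s.a k) j y)).ram τ := by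
  simp only [ram, State.set, seta, State.mk.injEq, and_true]
  funext z
  by_cases h : z = j * 16 + (k + 2)
  · subst h
    have h : (j * 16 + (k + 2)) % 16 = k + 2 := by omega
    have h' : (j * 16 + ((k : ℕ) + 2)) / 16 = j := by omega
    simp [h, h']
  · rw [Function.update_of_ne h]
    split_ifs with h0 h1
    · rfl
    · rfl
    · by_cases hk : (⟨z % 16 - 2, by omega⟩ : Fin 14) = k
      · subst hk
        rw [Function.update_self, Function.update_of_ne]
        rintro rfl
        simp only at h
        omega
      · rw [Function.update_of_ne hk]

end Env

/-- Expressions. `fold i a N e b` starts with the value of `e` and, for every `i` below the value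
of `N`, replaces the accumulator `a` by the value of `b`. -/
inductive Ex : Type
  | var (x : ℕ)
  | lit (c : ℕ)
  | add (e f : Ex)
  | sub (e f : Ex)
  | mul (e f : Ex)
  | div (e f : Ex)
  | arr (k : Fin 14) (e : Ex)
  | ite (c e f : Ex)
  | fold (i a : ℕ) (N e b : Ex)

namespace Ex

def eval : Ex → Env → ℕ
  | var x, s => s.v x
  | lit c, _ => c
  | add e f, s => e.eval s + f.eval s
  | sub e f, s => e.eval s - f.eval s
  | mul e f, s => e.eval s * f.eval s
  | div e f, s => e.eval s / f.eval s
  | arr k e, s => s.a k (e.eval s)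
  | ite c e f, s => if c.eval s ≠ 0 then e.eval s else f.eval s
  | fold i a N e b, s =>
    iter (fun j y => b.eval ((s.setv i j).setv a y)) (N.eval s) (e.eval s)

/-- Loop bounds and sizes of second factors are at most `M`. -/
def Ok (M : ℕ) : Ex → Env → Prop
  | var _, _ => True
  | lit _, _ => True
  | add e f, s => e.Ok M s ∧ f.Ok M s
  | sub e f, s => e.Ok M s ∧ f.Ok M s
  | mul e f, s => e.Ok M s ∧ f.Ok M s ∧ (f.eval s).size ≤ M
  | div e f, s => e.Ok M s ∧ f.Ok M s
  | arr _ e, s => e.Ok M s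
  | ite c e f, s => c.Ok M s ∧ e.Ok M s ∧ f.Ok M s
  | fold i a N e b, s => N.Ok M s ∧ e.Ok M s ∧ N.eval s ≤ M ∧
      ∀ j < N.eval s, ∀ y, b.Ok M ((s.setv i j).setv a y)

/-- The charge of an evaluation, as a polynomial in the bound `M` of `Ok`. -/
noncomputable def charge : Ex → Polynomial ℕ
  | var _ => 1
  | lit _ => 1
  | add e f => e.charge + f.charge + 1
  | sub e f => e.charge + f.charge + 1
  | mul e f => e.charge + f.charge + (1 + .X)
  | div e f => e.charge + f.charge + 1
  | arr _ e => e.charge + 14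
  | ite c e f => c.charge + e.charge + f.charge + 1
  | fold _ _ N e b => N.charge + e.charge + .X * (b.charge + 8) + 10

end Ex

/-- Code that turns the index in the auxiliary register `d` into an address in the array `k`, by
means of the auxiliary register `e`. -/
def address (d e : ℕ) (k : Fin 14) : Prog :=
  .seq (.const (16 * e + 1) 16) <|
  .seq (.mul (16 * d + 1) (16 * d + 1) (16 * e + 1)) <|
  .seq (.const (16 * e + 1) (k + 2)) <|
  .add (16 * d + 1) (16 * d + 1) (16 * e + 1)

/-- The loop that counts the auxiliary register `c` up to the content of `d`, by means of a test
register `r`. -/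
def countLoop (c d r : ℕ) (p : Prog) : Prog :=
  .while (16 * r + 1) <| .seq p <| .seq (.const (16 * r + 1) 1) <|
    .seq (.add (16 * c + 1) (16 * c + 1) (16 * r + 1)) <|
    .sub (16 * r + 1) (16 * d + 1) (16 * c + 1)

/-- Code that evaluates an expression into the auxiliary register `d`; it leaves the lower
auxiliary registers, the variables and the arrays unchanged. -/
def Ex.compile : Ex → ℕ → Prog
  | var x, d => .copy (16 * d + 1) (16 * x)
  | lit c, d => .const (16 * d + 1) c
  | add e f, d => .seq (e.compile d) <| .seq (f.compile (d + 1)) <|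
      .add (16 * d + 1) (16 * d + 1) (16 * (d + 1) + 1)
  | sub e f, d => .seq (e.compile d) <| .seq (f.compile (d + 1)) <|
      .sub (16 * d + 1) (16 * d + 1) (16 * (d + 1) + 1)
  | mul e f, d => .seq (e.compile d) <| .seq (f.compile (d + 1)) <|
      .mul (16 * d + 1) (16 * d + 1) (16 * (d + 1) + 1)
  | div e f, d => .seq (e.compile d) <| .seq (f.compile (d + 1)) <|
      .div (16 * d + 1) (16 * d + 1) (16 * (d + 1) + 1)
  | arr k e, d => .seq (e.compile d) <| .seq (address d (d + 1) k) <|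
      .load (16 * d + 1) (16 * d + 1)
  | ite c e f, d => .seq (c.compile d) <| .ite (16 * d + 1) (e.compile d) (f.compile d)
  | fold i a N e b, d =>
      .seq (N.compile d) <| .seq (e.compile (d + 1)) <|
      .seq (.copy (16 * (d + 2) + 1) (16 * i)) <|
      .seq (.copy (16 * (d + 3) + 1) (16 * a)) <|
      .seq (.copy (16 * a) (16 * (d + 1) + 1)) <|
      .seq (.const (16 * (d + 1) + 1) 0) <|
      .seq (.copy (16 * (d + 4) + 1) (16 * d + 1)) <|
      .seq (countLoop (d + 1) d (d + 4) <|
        .seq (.copy (16 * (d + 5) + 1) (16 * a)) <|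
        .seq (.copy (16 * i) (16 * (d + 1) + 1)) <|
        .seq (.copy (16 * a) (16 * (d + 5) + 1)) <|
        .seq (b.compile (d + 5)) <|
        .copy (16 * a) (16 * (d + 5) + 1)) <|
      .seq (.copy (16 * d + 1) (16 * a)) <|
      .seq (.copy (16 * i) (16 * (d + 2) + 1)) <|
      .copy (16 * a) (16 * (d + 3) + 1)

/-- Statements. `for i N b` runs `b` for every `i` below the value of `N`, and restores `i`. -/
inductive Stmt : Type
  | assign (x : ℕ) (e : Ex)
  | write (k : Fin 14) (e f : Ex)
  | read (x : ℕ)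
  | seq (p q : Stmt)
  | for (i : ℕ) (N : Ex) (b : Stmt)

namespace Stmt

def eval : Stmt → Env → Env
  | assign x e, s => s.setv x (e.eval s)
  | write k e f, s => s.seta k (Function.update (s.a k) (e.eval s) (f.eval s))
  | read x, s => s.pop x
  | seq p q, s => q.eval (p.eval s)
  | .for i N b, s => (iter (fun j s => b.eval (s.setv i j)) (N.eval s) s).setv i (s.v i)

/-- Loop bounds, sizes of second factors and sizes of the numbers read are at most `M`. -/
def Ok (M : ℕ) : Stmt → Env → Prop
  | assign _ e, s => e.Ok M s
  | write _ e f, s => e.Ok M s ∧ f.Ok M s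
  | read _, s => (s.inp.headD 0).size ≤ M
  | seq p q, s => p.Ok M s ∧ q.Ok M (p.eval s)
  | .for i N b, s => N.Ok M s ∧ N.eval s ≤ M ∧
      ∀ j < N.eval s, b.Ok M ((iter (fun j s => b.eval (s.setv i j)) j s).setv i j)

/-- The charge of a run, as a polynomial in the bound `M` of `Ok`. -/
noncomputable def charge : Stmt → Polynomial ℕ
  | assign _ e => e.charge + 1
  | write _ e f => e.charge + f.charge + 10
  | read _ => 1 + .X
  | seq p q => p.charge + q.charge
  | .for _ N b => N.charge + .X * (b.charge + 5) + 5

/-- Code of a statement that uses the auxiliary registers from `d` on. -/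
def compile : Stmt → ℕ → Prog
  | assign x e, d => .seq (e.compile d) (.copy (16 * x) (16 * d + 1))
  | write k e f, d => .seq (e.compile d) <| .seq (f.compile (d + 1)) <|
      .seq (address d (d + 2) k) <| .store (16 * d + 1) (16 * (d + 1) + 1)
  | read x, _ => .read (16 * x)
  | seq p q, d => .seq (p.compile d) (q.compile d)
  | .for i N b, d => .seq (N.compile d) <|
      .seq (.const (16 * (d + 1) + 1) 0) <|
      .seq (.copy (16 * (d + 2) + 1) (16 * i)) <|
      .seq (.copy (16 * (d + 3) + 1) (16 * d + 1)) <|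
      .seq (countLoop (d + 1) d (d + 3) <|
        .seq (.copy (16 * i) (16 * (d + 1) + 1)) (b.compile (d + 4))) <|
      .copy (16 * i) (16 * (d + 2) + 1)

end Stmt
end RAM

/-! ### Correctness and cost of the compiled code. -/

namespace RAM

theorem runs_copy_aux_var (s : Env) (τ : ℕ → ℕ) (d x : ℕ) :
    Runs (.copy (16 * d + 1) (16 * x)) (s.ram τ) 1 (s.ram (Function.update τ d (s.v x))) := by
  simpa only [Env.ram_mem_var, Env.ram_set_aux] using runs_copy (16 * d + 1) (16 * x) (s.ram τ)

theorem runs_copy_var_aux (s : Env) (τ : ℕ → ℕ) (x d : ℕ) :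
    Runs (.copy (16 * x) (16 * d + 1)) (s.ram τ) 1 ((s.setv x (τ d)).ram τ) := by
  simpa only [Env.ram_mem_aux, Env.ram_set_var] using runs_copy (16 * x) (16 * d + 1) (s.ram τ)

theorem runs_copy_aux (s : Env) (τ : ℕ → ℕ) (d e : ℕ) :
    Runs (.copy (16 * d + 1) (16 * e + 1)) (s.ram τ) 1 (s.ram (Function.update τ d (τ e))) := by
  simpa only [Env.ram_mem_aux, Env.ram_set_aux] using
    runs_copy (16 * d + 1) (16 * e + 1) (s.ram τ)

theorem runs_const_aux (s : Env) (τ : ℕ → ℕ) (d c : ℕ) :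
    Runs (.const (16 * d + 1) c) (s.ram τ) 1 (s.ram (Function.update τ d c)) := by
  simpa only [Env.ram_set_aux] using runs_const (16 * d + 1) c (s.ram τ)

theorem runs_add_aux (s : Env) (τ : ℕ → ℕ) (d e f : ℕ) :
    Runs (.add (16 * d + 1) (16 * e + 1) (16 * f + 1)) (s.ram τ) 1
      (s.ram (Function.update τ d (τ e + τ f))) := by
  simpa only [Env.ram_mem_aux, Env.ram_set_aux] using
    runs_add (16 * d + 1) (16 * e + 1) (16 * f + 1) (s.ram τ)

theorem runs_sub_aux (s : Env) (τ : ℕ → ℕ) (d e f : ℕ) :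
    Runs (.sub (16 * d + 1) (16 * e + 1) (16 * f + 1)) (s.ram τ) 1
      (s.ram (Function.update τ d (τ e - τ f))) := by
  simpa only [Env.ram_mem_aux, Env.ram_set_aux] using
    runs_sub (16 * d + 1) (16 * e + 1) (16 * f + 1) (s.ram τ)

theorem runs_div_aux (s : Env) (τ : ℕ → ℕ) (d e f : ℕ) :
    Runs (.div (16 * d + 1) (16 * e + 1) (16 * f + 1)) (s.ram τ) 1
      (s.ram (Function.update τ d (τ e / τ f))) := by
  simpa only [Env.ram_mem_aux, Env.ram_set_aux] using
    runs_div (16 * d + 1) (16 * e + 1) (16 * f + 1) (s.ram τ)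

theorem runs_mul_aux (s : Env) (τ : ℕ → ℕ) (d e f : ℕ) :
    Runs (.mul (16 * d + 1) (16 * e + 1) (16 * f + 1)) (s.ram τ) (1 + (τ f).size)
      (s.ram (Function.update τ d (τ e * τ f))) := by
  simpa only [Env.ram_mem_aux, Env.ram_set_aux] using
    runs_mul (16 * d + 1) (16 * e + 1) (16 * f + 1) (s.ram τ)

/-- The address of an array cell, computed in the auxiliary register `d`. -/
theorem runs_address (s : Env) (τ : ℕ → ℕ) (d e : ℕ) (hde : d ≠ e) (k : Fin 14) :
    ∃ τ', Runs (address d e k) (s.ram τ) 9 (s.ram τ') ∧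
      τ' d = τ d * 16 + (k + 2) ∧ ∀ t, t ≠ d → t ≠ e → τ' t = τ t := by
  refine ⟨_, ((runs_const_aux s τ e 16).seq ((runs_mul_aux s _ d d e).seq
    ((runs_const_aux s _ e (k + 2)).seq (runs_add_aux s _ d d e)))).mono ?_, ?_, ?_⟩
  -- The charge 9 consists of four instructions and the five binary digits of the factor 16.
  · have : Nat.size 16 = 5 := by decide
    simp [this]
  · simp [hde]
  · intro t h h'
    simp [h, h']

theorem runs_load_aux (s : Env) (τ : ℕ → ℕ) (d : ℕ) (k : Fin 14) (j : ℕ)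
    (h : τ d = j * 16 + (k + 2)) :
    Runs (.load (16 * d + 1) (16 * d + 1)) (s.ram τ) 1
      (s.ram (Function.update τ d (s.a k j))) := by
  simpa only [Env.ram_mem_aux, Env.ram_set_aux, h, Env.ram_mem_arr] using
    runs_load (16 * d + 1) (16 * d + 1) (s.ram τ)

/-- The loop that counts the auxiliary register `c` up to the content `n` of `d`, by means of a
test register `r`; the body may use auxiliary registers from `m` on. -/
theorem runs_loop {p : Prog} {c d r m K n : ℕ} (E : ℕ → Env) (hc : c < m)
    (hd : d < m) (hcd : c ≠ d) (hcr : c ≠ r) (hdr : d ≠ r)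
    (hp : ∀ j < n, ∀ τ, τ c = j → ∃ τ', Runs p ((E j).ram τ) K ((E (j + 1)).ram τ') ∧
      ∀ t < m, τ' t = τ t) (j : ℕ) (hj : j ≤ n) (τ : ℕ → ℕ) (h₁ : τ c = j) (h₂ : τ d = n)
    (h₃ : τ r = n - j) :
    ∃ τ', Runs (countLoop c d r p) ((E j).ram τ)
        ((n - j) * (K + 4) + 1) ((E n).ram τ') ∧
      ∀ t < m, t ≠ c → t ≠ r → τ' t = τ t := by
  induction h : n - j generalizing j τ with
  | zero =>
    obtain rfl : j = n := by omega
    refine ⟨τ, (runs_while_false _ ?_).mono (by omega), fun _ _ _ _ => rfl⟩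
    rw [Env.ram_mem_aux, h₃, h]
  | succ k ih =>
    obtain ⟨τ', h', hτ⟩ := hp j (by omega) τ h₁
    obtain ⟨τ'', h'', hτ''⟩ := ih (j + 1) (by omega)
      (Function.update (Function.update (Function.update τ' r 1) c (j + 1)) r (n - (j + 1)))
      (by simp [hcr]) (by simp [hdr, hcd.symm, hτ d hd, h₂]) (by simp) (by omega)
    refine ⟨τ'', (Runs.while_true (K := K + 3) (K' := k * (K + 4) + 1) ?_ (h'.seq
      ((runs_const_aux _ _ _ _).seq
      ((runs_add_aux _ _ _ _ _).seq (runs_sub_aux _ _ _ _ _)))) ?_).mono ?_, ?_⟩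
    · rw [Env.ram_mem_aux, h₃, h]; omega
    · change Runs (countLoop c d r p) _ _ _
      convert h'' using 2
      simp [hcr, hdr, hcd.symm, hτ d hd, h₂, hτ c hc, h₁]
    · rw [add_mul]; omega
    · intro t ht htc htr
      rw [hτ'' t ht htc htr]
      simp [htc, htr, hτ t ht]

/-- Needed to set the loop counter and the accumulator of a fold in each round and to restore them
at the end. The case `i = a` is included: the write to `a` comes last on both sides, so no
distinctness of the two variables has to be assumed. -/
theorem Env.setv_two_overwrite (s : Env) (i a x y z w : ℕ) :
    (((s.setv i x).setv a y).setv i z).setv a w = (s.setv i z).setv a w := by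
  by_cases h : i = a
  · subst h; simp
  · rw [(s.setv i x).setv_comm (Ne.symm h), setv_setv, setv_setv]

namespace Ex

theorem runs_compile (M : ℕ) (e : Ex) : ∀ (d : ℕ) (s : Env) (τ : ℕ → ℕ), e.Ok M s →
    ∃ τ', Runs (e.compile d) (s.ram τ) (e.charge.eval M) (s.ram τ') ∧ τ' d = e.eval s ∧
      ∀ t < d, τ' t = τ t := by
  -- The four binary operations share one pattern: the code for `f` works from register `d + 1` on,
  -- so the value of `e` survives in `d`.
  have binary : ∀ {e f : Ex} {d : ℕ} {s : Env} {τ : ℕ → ℕ} {K₁ K₂ : ℕ},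
      (∃ τ', Runs (e.compile d) (s.ram τ) K₁ (s.ram τ') ∧ τ' d = e.eval s ∧
        ∀ t < d, τ' t = τ t) →
      (∀ τ, ∃ τ', Runs (f.compile (d + 1)) (s.ram τ) K₂ (s.ram τ') ∧ τ' (d + 1) = f.eval s ∧
        ∀ t < d + 1, τ' t = τ t) →
      ∀ {p : Prog} {x K : ℕ}, (∀ τ : ℕ → ℕ, τ d = e.eval s → τ (d + 1) = f.eval s →
        Runs p (s.ram τ) K (s.ram (Function.update τ d x))) →
      ∃ τ', Runs (.seq (e.compile d) (.seq (f.compile (d + 1)) p)) (s.ram τ) (K₁ + K₂ + K)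
        (s.ram τ') ∧ τ' d = x ∧ ∀ t < d, τ' t = τ t := by
    rintro e f d s τ K₁ K₂ ⟨τ₁, h₁, hv₁, hl₁⟩ hf p x K hp
    obtain ⟨τ₂, h₂, hv₂, hl₂⟩ := hf τ₁
    refine ⟨_, (h₁.seq (h₂.seq (hp τ₂ ?_ hv₂))).mono (by omega), by simp, ?_⟩
    · rw [hl₂ d (by omega), hv₁]
    · intro t ht
      rw [Function.update_of_ne (by omega), hl₂ t (by omega), hl₁ t ht]
  induction e with
  | var x =>
    intro d s τ _
    refine ⟨_, (runs_copy_aux_var s τ d x).mono (by simp [charge]), by simp [eval], ?_⟩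
    intro t ht
    simp [ht.ne]
  | lit c =>
    intro d s τ _
    refine ⟨_, (runs_const_aux s τ d c).mono (by simp [charge]), by simp [eval], ?_⟩
    intro t ht
    simp [ht.ne]
  | add e f ihe ihf =>
    intro d s τ h
    simp only [charge, Polynomial.eval_add, Polynomial.eval_one]
    refine binary (ihe d s τ h.1) (fun τ => ihf (d + 1) s τ h.2) fun τ h₁ h₂ => ?_
    simpa only [h₁, h₂, eval] using runs_add_aux s τ d d (d + 1)
  | sub e f ihe ihf =>
    intro d s τ h
    simp only [charge, Polynomial.eval_add, Polynomial.eval_one]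
    refine binary (ihe d s τ h.1) (fun τ => ihf (d + 1) s τ h.2) fun τ h₁ h₂ => ?_
    simpa only [h₁, h₂, eval] using runs_sub_aux s τ d d (d + 1)
  | mul e f ihe ihf =>
    intro d s τ h
    simp only [charge, Polynomial.eval_add, Polynomial.eval_one, Polynomial.eval_X]
    refine binary (ihe d s τ h.1) (fun τ => ihf (d + 1) s τ h.2.1) fun τ h₁ h₂ => ?_
    have := runs_mul_aux s τ d d (d + 1)
    simp only [h₁, h₂] at this
    exact this.mono (Nat.add_le_add_left h.2.2 1)
  | div e f ihe ihf =>
    intro d s τ h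
    simp only [charge, Polynomial.eval_add, Polynomial.eval_one]
    refine binary (ihe d s τ h.1) (fun τ => ihf (d + 1) s τ h.2) fun τ h₁ h₂ => ?_
    simpa only [h₁, h₂, eval] using runs_div_aux s τ d d (d + 1)
  | arr k e ih =>
    intro d s τ h
    obtain ⟨τ₁, h₁, hv₁, hl₁⟩ := ih d s τ h
    obtain ⟨τ₂, h₂, hv₂, hl₂⟩ := runs_address s τ₁ d (d + 1) (by omega) k
    have h₃ := runs_load_aux s τ₂ d k _ hv₂
    refine ⟨_, (h₁.seq (h₂.seq h₃)).mono ?_, ?_, ?_⟩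
    · simp [charge]
    · simp [eval, hv₁]
    · intro t ht
      rw [Function.update_of_ne (by omega), hl₂ t (by omega) (by omega), hl₁ t ht]
  | ite c e f ihc ihe ihf =>
    intro d s τ h
    obtain ⟨τ₁, h₁, hv₁, hl₁⟩ := ihc d s τ h.1
    simp only [charge, Polynomial.eval_add, Polynomial.eval_one]
    by_cases hc : c.eval s = 0
    · obtain ⟨τ₂, h₂, hv₂, hl₂⟩ := ihf d s τ₁ h.2.2
      refine ⟨τ₂, (h₁.seq (h₂.ite_false _ ?_)).mono (by omega), ?_, ?_⟩
      · rw [Env.ram_mem_aux, hv₁, hc]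
      · simp [eval, hc, hv₂]
      · intro t ht
        rw [hl₂ t ht, hl₁ t ht]
    · obtain ⟨τ₂, h₂, hv₂, hl₂⟩ := ihe d s τ₁ h.2.1
      refine ⟨τ₂, (h₁.seq (h₂.ite_true _ ?_)).mono (by omega), ?_, ?_⟩
      · rwa [Env.ram_mem_aux, hv₁]
      · simp [eval, hc, hv₂]
      · intro t ht
        rw [hl₂ t ht, hl₁ t ht]
  | fold i a N e b ihN ihe ihb =>
    intro d s τ h
    obtain ⟨hN, he, hM, hb⟩ := h
    obtain ⟨τ₁, h₁, hv₁, hl₁⟩ := ihN d s τ hN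
    obtain ⟨τ₂, h₂, hv₂, hl₂⟩ := ihe (d + 1) s τ₁ he
    set g : ℕ → ℕ := fun n => iter (fun j y => b.eval ((s.setv i j).setv a y)) n (e.eval s) with hg
    -- `E j` is the environment at the loop test before round `j`. The counter `i` is written inside
    -- the round, so at the test it still holds `j - 1`, or its original value when `j = 0`.
    set E : ℕ → Env := fun j => (s.setv i (if j = 0 then s.v i else j - 1)).setv a (g j) with hE
    have h₃ := runs_copy_aux_var s τ₂ (d + 2) i
    have h₄ := runs_copy_aux_var s (Function.update τ₂ (d + 2) (s.v i)) (d + 3) a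
    set τ₃ := Function.update (Function.update τ₂ (d + 2) (s.v i)) (d + 3) (s.v a) with hτ₃
    have h₅ := runs_copy_var_aux s τ₃ a (d + 1)
    have h₆ := runs_const_aux (s.setv a (τ₃ (d + 1))) τ₃ (d + 1) 0
    have h₇ := runs_copy_aux (s.setv a (τ₃ (d + 1))) (Function.update τ₃ (d + 1) 0) (d + 4) d
    have hE₀ : s.setv a (τ₃ (d + 1)) = E 0 := by simp [hE, hg, iter, hτ₃, hv₂]
    rw [hE₀] at h₅ h₆ h₇
    have hd : τ₂ d = N.eval s := by rw [hl₂ d (by omega), hv₁]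
    have hp : ∀ j < N.eval s, ∀ τ : ℕ → ℕ, τ (d + 1) = j → ∃ τ',
        Runs (.seq (.copy (16 * (d + 5) + 1) (16 * a)) <|
          .seq (.copy (16 * i) (16 * (d + 1) + 1)) <|
          .seq (.copy (16 * a) (16 * (d + 5) + 1)) <|
          .seq (b.compile (d + 5)) <|
          .copy (16 * a) (16 * (d + 5) + 1)) ((E j).ram τ) (b.charge.eval M + 4)
          ((E (j + 1)).ram τ') ∧ ∀ t < d + 5, τ' t = τ t := by
      intro j hj τ hτ
      have k₁ := runs_copy_aux_var (E j) τ (d + 5) a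
      have k₂ := runs_copy_var_aux (E j) (Function.update τ (d + 5) ((E j).v a)) i (d + 1)
      have k₃ := runs_copy_var_aux ((E j).setv i (Function.update τ (d + 5) ((E j).v a) (d + 1)))
        (Function.update τ (d + 5) ((E j).v a)) a (d + 5)
      have hs : (((E j).setv i (Function.update τ (d + 5) ((E j).v a) (d + 1))).setv a
          (Function.update τ (d + 5) ((E j).v a) (d + 5))) = (s.setv i j).setv a (g j) := by
        simp [hE, hτ, Env.setv_two_overwrite]
      rw [hs] at k₃
      obtain ⟨τ', k₄, hv, hl⟩ := ihb (d + 5) _ (Function.update τ (d + 5) ((E j).v a))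
        (hb j hj (g j))
      have k₅ := runs_copy_var_aux ((s.setv i j).setv a (g j)) τ' a (d + 5)
      refine ⟨τ', ?_, ?_⟩
      · convert (k₁.seq <| k₂.seq <| k₃.seq <| k₄.seq k₅).mono _ using 2
        · simp [hE, hg, iter, hv]
        · omega
      · intro t ht
        rw [hl t ht, Function.update_of_ne (by omega)]
    obtain ⟨τ₄, h₈, hl₄⟩ := runs_loop (d := d) (r := d + 4) E (by omega) (by omega)
      (by omega) (by omega) (by omega) hp 0 (Nat.zero_le _) (Function.update
        (Function.update τ₃ (d + 1) 0) (d + 4) (Function.update τ₃ (d + 1) 0 d))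
      (by simp) (by simp [hτ₃, hd]) (by simp [hτ₃, hd])
    have h₉ := runs_copy_aux_var (E (N.eval s)) τ₄ d a
    have h₁₀ := runs_copy_var_aux (E (N.eval s))
      (Function.update τ₄ d ((E (N.eval s)).v a)) i (d + 2)
    have h₁₁ := runs_copy_var_aux ((E (N.eval s)).setv i
      (Function.update τ₄ d ((E (N.eval s)).v a) (d + 2)))
      (Function.update τ₄ d ((E (N.eval s)).v a)) a (d + 3)
    rw [Function.update_of_ne (by omega), Function.update_of_ne (by omega),
      hl₄ (d + 2) (by omega) (by omega) (by omega),
      hl₄ (d + 3) (by omega) (by omega) (by omega)] at h₁₁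
    have hs : ((E (N.eval s)).setv i (Function.update (Function.update τ₃ (d + 1) 0) (d + 4)
        (Function.update τ₃ (d + 1) 0 d) (d + 2))).setv a (Function.update
        (Function.update τ₃ (d + 1) 0) (d + 4) (Function.update τ₃ (d + 1) 0 d) (d + 3)) = s := by
      simp [hE, hτ₃, Env.setv_two_overwrite]
    rw [hs] at h₁₁
    rw [Function.update_of_ne (by omega), hl₄ (d + 2) (by omega) (by omega) (by omega)] at h₁₀
    refine ⟨Function.update τ₄ d ((E (N.eval s)).v a), (h₁.seq <| h₂.seq <| h₃.seq <| h₄.seq <|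
      h₅.seq <| h₆.seq <| h₇.seq <| h₈.seq <| h₉.seq <| h₁₀.seq h₁₁).mono ?_, ?_, ?_⟩
    · simp only [charge, Polynomial.eval_add, Polynomial.eval_mul, Polynomial.eval_X,
        Polynomial.eval_ofNat, Nat.sub_zero]
      have : N.eval s * (b.charge.eval M + 4 + 4) ≤ M * (b.charge.eval M + 8) := by gcongr
      omega
    · simp [hE, hg, eval]
    · intro t ht
      rw [Function.update_of_ne (by omega), hl₄ t (by omega) (by omega) (by omega)]
      have h1 : t ≠ d + 4 := by omega
      have h2 : t ≠ d + 1 := by omega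
      have h3 : t ≠ d + 2 := by omega
      have h4 : t ≠ d + 3 := by omega
      simp [hτ₃, h1, h2, h3, h4, hl₂ t (by omega), hl₁ t ht]

end Ex

namespace Stmt

theorem runs_compile (M : ℕ) (p : Stmt) : ∀ (d : ℕ) (s : Env) (τ : ℕ → ℕ), p.Ok M s →
    ∃ τ', Runs (p.compile d) (s.ram τ) (p.charge.eval M) ((p.eval s).ram τ') ∧
      ∀ t < d, τ' t = τ t := by
  induction p with
  | assign x e =>
    intro d s τ h
    obtain ⟨τ₁, h₁, hv₁, hl₁⟩ := e.runs_compile M d s τ h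
    have h₂ := runs_copy_var_aux s τ₁ x d
    rw [hv₁] at h₂
    exact ⟨τ₁, (h₁.seq h₂).mono (by simp [charge]), hl₁⟩
  | write k e f =>
    intro d s τ h
    obtain ⟨τ₁, h₁, hv₁, hl₁⟩ := e.runs_compile M d s τ h.1
    obtain ⟨τ₂, h₂, hv₂, hl₂⟩ := f.runs_compile M (d + 1) s τ₁ h.2
    obtain ⟨τ₃, h₃, hv₃, hl₃⟩ := runs_address s τ₂ d (d + 2) (by omega) k
    have h₄ := runs_store (16 * d + 1) (16 * (d + 1) + 1) (s.ram τ₃)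
    rw [Env.ram_mem_aux, Env.ram_mem_aux, hv₃, Env.ram_set_arr,
      hl₃ (d + 1) (by omega) (by omega), hv₂, hl₂ d (by omega), hv₁] at h₄
    refine ⟨τ₃, (h₁.seq (h₂.seq (h₃.seq h₄))).mono ?_, ?_⟩
    · simp only [charge, Polynomial.eval_add, Polynomial.eval_ofNat]
      omega
    · intro t ht
      rw [hl₃ t (by omega) (by omega), hl₂ t (by omega), hl₁ t ht]
  | read x =>
    intro d s τ h
    have h₁ := runs_read (16 * x) (s.ram τ)
    rw [Env.ram_set_var] at h₁
    refine ⟨τ, h₁.mono ?_, fun _ _ => rfl⟩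
    simpa [charge, Ok] using h
  | seq p q ihp ihq =>
    intro d s τ h
    obtain ⟨τ₁, h₁, hl₁⟩ := ihp d s τ h.1
    obtain ⟨τ₂, h₂, hl₂⟩ := ihq d _ τ₁ h.2
    refine ⟨τ₂, (h₁.seq h₂).mono (by simp [charge]), ?_⟩
    intro t ht
    rw [hl₂ t ht, hl₁ t ht]
  | _ i N b ih =>
    intro d s τ h
    obtain ⟨hN, hM, hb⟩ := h
    obtain ⟨τ₁, h₁, hv₁, hl₁⟩ := N.runs_compile M d s τ hN
    set E : ℕ → Env := fun n => iter (fun j s => b.eval (s.setv i j)) n s with hE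
    have h₂ := runs_const_aux s τ₁ (d + 1) 0
    have h₃ := runs_copy_aux_var s (Function.update τ₁ (d + 1) 0) (d + 2) i
    set τ₂ := Function.update (Function.update τ₁ (d + 1) 0) (d + 2) (s.v i) with hτ₂
    have h₄ := runs_copy_aux s τ₂ (d + 3) d
    have hp : ∀ j < N.eval s, ∀ τ : ℕ → ℕ, τ (d + 1) = j → ∃ τ',
        Runs (.seq (.copy (16 * i) (16 * (d + 1) + 1)) (b.compile (d + 4))) ((E j).ram τ)
          (b.charge.eval M + 1) ((E (j + 1)).ram τ') ∧ ∀ t < d + 4, τ' t = τ t := by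
      intro j hj τ hτ
      have k₁ := runs_copy_var_aux (E j) τ i (d + 1)
      rw [hτ] at k₁
      obtain ⟨τ', k₂, hl⟩ := ih (d + 4) _ τ (hb j hj)
      exact ⟨τ', (k₁.seq k₂).mono (by omega), hl⟩
    obtain ⟨τ₃, h₅, hl₃⟩ := runs_loop (d := d) (r := d + 3) E (by omega) (by omega)
      (by omega) (by omega) (by omega) hp 0 (Nat.zero_le _) (Function.update τ₂ (d + 3) (τ₂ d))
      (by simp [hτ₂]) (by simp [hτ₂, hv₁]) (by simp [hτ₂, hv₁])
    have h₆ := runs_copy_var_aux (E (N.eval s)) τ₃ i (d + 2)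
    rw [hl₃ (d + 2) (by omega) (by omega) (by omega), Function.update_of_ne (by omega), hτ₂,
      Function.update_self] at h₆
    refine ⟨τ₃, (h₁.seq <| h₂.seq <| h₃.seq <| h₄.seq <| h₅.seq h₆).mono ?_, ?_⟩
    · simp only [charge, Polynomial.eval_add, Polynomial.eval_mul, Polynomial.eval_X,
        Polynomial.eval_ofNat, Nat.sub_zero]
      have : N.eval s * (b.charge.eval M + 1 + 4) ≤ M * (b.charge.eval M + 5) := by gcongr
      omega
    · intro t ht
      have h1 : t ≠ d + 1 := by omega
      have h2 : t ≠ d + 2 := by omega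
      have h3 : t ≠ d + 3 := by omega
      rw [hl₃ t (by omega) h1 h3]
      simp [hτ₂, h1, h2, h3, hl₁ t ht]

end Stmt

/-- The environment in which a statement is started. -/
def Env.initial (w : List ℕ) : Env := ⟨fun _ => 0, fun _ _ => 0, w⟩

theorem Env.ram_initial (w : List ℕ) : (Env.initial w).ram (fun _ => 0) = start w := by
  simp [Env.initial, Env.ram, start]

/-- The memory is zero at the start, so the constants of the program alone give the initial size
bound. Variable `0` lies in cell `16 * 0 = 0`, where the answer is expected. -/
theorem Stmt.exec_compile (p : Stmt) (M : ℕ) (w : List ℕ) (h : p.Ok M (.initial w)) :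
    ∃ t σ, Exec (p.compile 0) (start w) t σ ∧
      t ≤ 6 * p.charge.eval M * ((p.compile 0).statics + p.charge.eval M + 1) ∧
      σ.mem 0 = (p.eval (.initial w)).v 0 := by
  obtain ⟨τ, h₁, -⟩ := p.runs_compile M 0 _ (fun _ => 0) h
  rw [Env.ram_initial] at h₁
  obtain ⟨t, ht, hc, -⟩ := h₁ _ le_rfl (by simp [start])
  exact ⟨t, _, ht, hc, Env.ram_mem_var _ _ 0⟩

end RAM

namespace ConnectedDivision

/-! ### Serving players with disjoint connected bundles -/

open Finset

set_option linter.unusedSectionVars false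

variable {V : Type*} [DecidableEq V] (G : SimpleGraph V)

/-- The finite set `X` induces a connected graph, or is empty. -/
def Conn (X : Finset V) : Prop := (G.induce (X : Set V)).Preconnected

variable {G}

/-- Edges need only go to reachable pairs, so `f` may collapse edges to points, as the retraction in
`Conn.inter` does. -/
theorem reachable_map {V' : Type*} {G' : SimpleGraph V'} (f : V → V')
    (h : ∀ x y, G.Adj x y → G'.Reachable (f x) (f y)) {x y : V} (hxy : G.Reachable x y) :
    G'.Reachable (f x) (f y) := by
  obtain ⟨w⟩ := hxy
  induction w with
  | nil => rfl
  | cons hadj _ ih => exact (h _ _ hadj).trans ih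

/-- A connected set that is not inside `B` but meets it contains an edge that leaves `B`. -/
theorem Conn.exists_adj {X : Finset V} (hX : Conn G X) {B : Finset V} {x y : V} (hx : x ∈ X)
    (hxB : x ∈ B) (hy : y ∈ X) (hyB : y ∉ B) :
    ∃ u ∈ X, ∃ w ∈ X, u ∈ B ∧ w ∉ B ∧ G.Adj u w := by
  obtain ⟨w⟩ := hX ⟨x, hx⟩ ⟨y, hy⟩
  obtain ⟨d, -, h₁, h₂⟩ := w.exists_boundary_dart {z | (z : V) ∈ B} hxB hyB
  exact ⟨d.fst, d.fst.2, d.snd, d.snd.2, h₁, h₂, d.adj⟩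

/-- If all edges of a connected set `X` that leave `B` start in `p`, then `X ∩ B` is connected. -/
theorem Conn.inter {X : Finset V} (hX : Conn G X) {B : Finset V} {p : V} (hp : p ∈ X)
    (hpB : p ∈ B) (h : ∀ x ∈ X, x ∈ B → ∀ y ∈ X, y ∉ B → G.Adj x y → x = p) :
    Conn G (X ∩ B) := by
  -- The retraction of `X` onto `X ∩ B` that sends everything outside `B` to `p`. An edge between
  -- the two sides has its inner end at `p`, so it is collapsed.
  let f : ((X : Set V) : Type _) → (((X ∩ B : Finset V) : Set V) : Type _) := fun x =>
    if hx : (x : V) ∈ B then ⟨x, by simp [hx]⟩ else ⟨p, by simp [hp, hpB]⟩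
  have hf : ∀ x y, (G.induce (X : Set V)).Adj x y →
      (G.induce ((X ∩ B : Finset V) : Set V)).Reachable (f x) (f y) := by
    rintro ⟨x, hx⟩ ⟨y, hy⟩ hxy
    simp only [SimpleGraph.comap_adj, Function.Embedding.subtype_apply] at hxy
    by_cases hxB : x ∈ B <;> by_cases hyB : y ∈ B
    · simp only [f, hxB, hyB, dif_pos]
      exact SimpleGraph.Adj.reachable (by simpa using hxy)
    · obtain rfl := h x hx hxB y hy hyB hxy
      simp [f, hxB, hyB]
    · obtain rfl := h y hy hyB x hx hxB hxy.symm
      simp [f, hxB, hyB]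
    · simp [f, hxB, hyB]
  rintro ⟨x, hx⟩ ⟨y, hy⟩
  have hx' : x ∈ X ∧ x ∈ B := by simpa using hx
  have hy' : y ∈ X ∧ y ∈ B := by simpa using hy
  have := reachable_map f hf (hX ⟨x, hx'.1⟩ ⟨y, hy'.1⟩)
  simpa [f, hx'.2, hy'.2] using this

theorem Conn.union {X Y : Finset V} (hX : Conn G X) (hY : Conn G Y) {p c : V} (hp : p ∈ X)
    (hc : c ∈ Y) (h : G.Adj p c) : Conn G (X ∪ Y) := by
  have hX' : ∀ x (hx : x ∈ X), (G.induce ((X ∪ Y : Finset V) : Set V)).Reachable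
      ⟨x, by simp [hx]⟩ ⟨p, by simp [hp]⟩ := by
    intro x hx
    exact reachable_map (G' := G.induce ((X ∪ Y : Finset V) : Set V))
      (fun z : ((X : Set V) : Type _) => ⟨z.1, by have := z.2; simp_all⟩)
      (fun _ _ h => SimpleGraph.Adj.reachable (by simpa using h)) (hX ⟨x, hx⟩ ⟨p, hp⟩)
  have hY' : ∀ x (hx : x ∈ Y), (G.induce ((X ∪ Y : Finset V) : Set V)).Reachable
      ⟨x, by simp [hx]⟩ ⟨p, by simp [hp]⟩ := by
    intro x hx
    refine (reachable_map (G' := G.induce ((X ∪ Y : Finset V) : Set V))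
      (fun z : ((Y : Set V) : Type _) => ⟨z.1, by have := z.2; simp_all⟩)
      (fun _ _ h => SimpleGraph.Adj.reachable (by simpa using h)) (hY ⟨x, hx⟩ ⟨c, hc⟩)).trans
      (SimpleGraph.Adj.reachable (by simpa using h.symm))
  have key : ∀ x (hx : x ∈ X ∪ Y), (G.induce ((X ∪ Y : Finset V) : Set V)).Reachable
      ⟨x, hx⟩ ⟨p, by simp [hp]⟩ := by
    intro x hx
    rcases Finset.mem_union.1 hx with h | h
    · exact hX' x h
    · exact hY' x h
  rintro ⟨x, hx⟩ ⟨y, hy⟩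
  exact (key x hx).trans (key y hy).symm

theorem conn_singleton (v : V) : Conn G {v} := by
  rintro ⟨x, hx⟩ ⟨y, hy⟩
  obtain rfl : x = v := by simpa using hx
  obtain rfl : y = x := by simpa using hy
  rfl

variable (G) (W : ℕ → V → ℕ) (D : ℕ)

/-- The players in `A` can be given disjoint connected bundles inside `C`, each of weight at
least `D`. -/
def Serves (C : Finset V) (A : Finset ℕ) : Prop :=
  ∃ π : ℕ → Finset V, (∀ j ∈ A, π j ⊆ C ∧ Conn G (π j) ∧ D ≤ ∑ v ∈ π j, W j v) ∧
    ∀ j ∈ A, ∀ l ∈ A, j ≠ l → Disjoint (π j) (π l)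

/-- There is a connected bundle inside `B` that contains `v` and has weight at least `k` for `i`,
and the players in `A` can be served by the rest of `B`. -/
def Extends (B : Finset V) (v : V) (A : Finset ℕ) (i k : ℕ) : Prop :=
  ∃ X ⊆ B, v ∈ X ∧ Conn G X ∧ k ≤ ∑ x ∈ X, W i x ∧ Serves G W D (B \ X) A

variable {G W D}

theorem Serves.mono {C C' : Finset V} {A A' : Finset ℕ} (h : Serves G W D C A) (hC : C ⊆ C')
    (hA : A' ⊆ A) : Serves G W D C' A' := by
  obtain ⟨π, h₁, h₂⟩ := h
  exact ⟨π, fun j hj => ⟨(h₁ j (hA hj)).1.trans hC, (h₁ j (hA hj)).2⟩,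
    fun j hj l hl => h₂ j (hA hj) l (hA hl)⟩

theorem Serves.union {C C' : Finset V} {A A' : Finset ℕ} (h : Serves G W D C A)
    (h' : Serves G W D C' A') (hC : Disjoint C C') : Serves G W D (C ∪ C') (A ∪ A') := by
  obtain ⟨π, h₁, h₂⟩ := h
  obtain ⟨ρ, h₃, h₄⟩ := h'
  refine ⟨fun j => if j ∈ A then π j else ρ j, ?_, ?_⟩
  · intro j hj
    by_cases hA : j ∈ A
    · simp only [hA, if_true]
      exact ⟨(h₁ j hA).1.trans subset_union_left, (h₁ j hA).2⟩
    · have hA' : j ∈ A' := by simpa [hA] using hj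
      simp only [hA, if_false]
      exact ⟨(h₃ j hA').1.trans subset_union_right, (h₃ j hA').2⟩
  · intro j hj l hl hjl
    by_cases hA : j ∈ A <;> by_cases hB : l ∈ A
    · simp only [hA, hB, if_true]
      exact h₂ j hA l hB hjl
    · have hB' : l ∈ A' := by simpa [hB] using hl
      simp only [hA, hB, if_true, if_false]
      exact disjoint_of_subset_left (h₁ j hA).1 (disjoint_of_subset_right (h₃ l hB').1 hC)
    · have hA' : j ∈ A' := by simpa [hA] using hj
      simp only [hA, hB, if_true, if_false]
      exact disjoint_of_subset_left (h₃ j hA').1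
        (disjoint_of_subset_right (h₁ l hB).1 hC.symm)
    · have hA' : j ∈ A' := by simpa [hA] using hj
      have hB' : l ∈ A' := by simpa [hB] using hl
      simp only [hA, hB, if_false]
      exact h₄ j hA' l hB' hjl

theorem serves_empty (C : Finset V) : Serves G W D C ∅ :=
  ⟨fun _ => ∅, by simp, by simp⟩

theorem serves_singleton {X : Finset V} (hX : Conn G X) {i : ℕ} (h : D ≤ ∑ x ∈ X, W i x) :
    Serves G W D X {i} := by
  refine ⟨fun _ => X, ?_, ?_⟩
  · simp only [mem_singleton, forall_eq]
    exact ⟨Subset.rfl, hX, h⟩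
  · intro j hj l hl hjl
    simp_all

/-- Serving `A` inside `B`, by cases on the player `i` who gets `v`; the player `n`, who likes
every item, stands for the case that nobody gets it. -/
theorem serves_iff_exists_extends {n : ℕ} {B : Finset V} {v : V} (hv : v ∈ B) {A : Finset ℕ}
    (hA : A ⊆ range n) (hn : ∀ v, W n v = D) :
    Serves G W D B A ↔
      ∃ i < n + 1, ∃ A' ⊆ range n, (∀ j < n, j ∈ A ↔ j ∈ A' ∨ j = i) ∧ i ∉ A' ∧
        Extends G W D B v A' i D := by
  constructor
  · intro h
    have h' := h
    obtain ⟨π, h₁, h₂⟩ := h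
    by_cases hex : ∃ i ∈ A, v ∈ π i
    · obtain ⟨i, hi, hvi⟩ := hex
      have hin := mem_range.1 (hA hi)
      refine ⟨i, by omega, A.erase i, (erase_subset _ _).trans hA, ?_, by simp, π i,
        (h₁ i hi).1, hvi, (h₁ i hi).2.1, (h₁ i hi).2.2, π, ?_, ?_⟩
      · intro j _
        by_cases hji : j = i
        · simp [hji, hi]
        · simp [hji]
      · intro j hj
        rw [mem_erase] at hj
        exact ⟨subset_sdiff.2 ⟨(h₁ j hj.2).1, h₂ j hj.2 i hi hj.1⟩, (h₁ j hj.2).2⟩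
      · intro j hj l hl
        exact h₂ j (mem_of_mem_erase hj) l (mem_of_mem_erase hl)
    · push Not at hex
      -- Nobody holds `v`: the dummy player takes the bundle `{v}`, which has weight exactly `D` for
      -- it, and since `n` is not below `n` the set of served players is unchanged.
      refine ⟨n, by omega, A, hA, ?_, fun h => by simpa using hA h, {v}, by simpa using hv,
        by simp, conn_singleton v, by simp [hn], π, ?_, h₂⟩
      · intro j hj
        simp [hj.ne]
      · intro j hj
        refine ⟨subset_sdiff.2 ⟨(h₁ j hj).1, ?_⟩, (h₁ j hj).2⟩
        simpa using hex j hj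
  · rintro ⟨i, -, A', hA', h, -, X, hXB, -, hX, hk, hs⟩
    have h₁ := hs.union (serves_singleton hX hk) sdiff_disjoint
    rw [sdiff_union_of_subset hXB] at h₁
    refine h₁.mono Subset.rfl fun j hj => ?_
    rw [mem_union, mem_singleton]
    exact (h j (mem_range.1 (hA hj))).1 hj

/-- Configurations in two parts that are joined by the single edge `p c`. -/
theorem extends_union_iff {B C : Finset V} (hBC : Disjoint B C) {p c : V} (hp : p ∈ B)
    (hc : c ∈ C) (hpc : G.Adj p c)
    (hedge : ∀ x ∈ B, ∀ y ∈ C, G.Adj x y → x = p ∧ y = c) (A : Finset ℕ) (i k : ℕ) :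
    Extends G W D (B ∪ C) p A i k ↔
      ∃ A₁ ⊆ A, ∃ A₂ ⊆ A, A ⊆ A₁ ∪ A₂ ∧ Disjoint A₁ A₂ ∧ ∃ k₁ k₂, k ≤ k₁ + k₂ ∧
        Extends G W D B p A₁ i k₁ ∧
        (Extends G W D C c A₂ i k₂ ∨ k₂ = 0 ∧ Serves G W D C A₂) := by
  have hnot : ∀ x ∈ C, x ∉ B := fun x hx hx' => disjoint_left.1 hBC hx' hx
  constructor
  · rintro ⟨X, hXB, hpX, hX, hk, π, h₁, h₂⟩
    -- A connected bundle meeting both parts would use the edge `p c` and so contain `p`, which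
    -- already belongs to `X`.
    have hside : ∀ j ∈ A, π j ⊆ B ∨ π j ⊆ C := by
      intro j hj
      obtain ⟨hsub, hconn, -⟩ := h₁ j hj
      by_contra! hcon
      obtain ⟨x, hx, hxB⟩ := not_subset.1 hcon.1
      obtain ⟨y, hy, hyC⟩ := not_subset.1 hcon.2
      have hy' := mem_sdiff.1 (hsub hy)
      have hyB : y ∈ B := by simpa [hyC] using hy'.1
      obtain ⟨u, hu, w, hw, huB, hwB, huw⟩ := hconn.exists_adj hy hyB hx hxB
      have hw' := mem_sdiff.1 (hsub hw)
      have hwC : w ∈ C := by simpa [hwB] using hw'.1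
      have hu' := mem_sdiff.1 (hsub hu)
      obtain ⟨rfl, -⟩ := hedge u huB w hwC huw
      exact hu'.2 hpX
    have hXBconn : Conn G (X ∩ B) := hX.inter hpX hp fun x hx hxB y hy hyB hxy =>
      (hedge x hxB y (by simpa [hyB] using hXB hy) hxy).1
    have hsum : ∑ x ∈ X, W i x = ∑ x ∈ X ∩ B, W i x + ∑ x ∈ X ∩ C, W i x := by
      rw [← sum_union (disjoint_of_subset_left inter_subset_right
        (disjoint_of_subset_right inter_subset_right hBC)), ← inter_union_distrib_left,
        inter_eq_left.2 hXB]
    refine ⟨A.filter fun j => π j ⊆ B, filter_subset _ _, A.filter fun j => ¬ π j ⊆ B,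
      filter_subset _ _, by rw [filter_union_filter_not_eq], disjoint_filter_filter_not _ _ _,
      ∑ x ∈ X ∩ B, W i x, ∑ x ∈ X ∩ C, W i x, hsum ▸ hk, ?_, ?_⟩
    · refine ⟨X ∩ B, inter_subset_right, by simp [hpX, hp], hXBconn, le_rfl, π, ?_, ?_⟩
      · intro j hj
        rw [mem_filter] at hj
        refine ⟨fun x hx => ?_, (h₁ j hj.1).2⟩
        have := (h₁ j hj.1).1 hx
        simp only [mem_sdiff, mem_inter] at this ⊢
        exact ⟨hj.2 hx, fun h => this.2 h.1⟩
      · intro j hj l hl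
        exact h₂ j (mem_filter.1 hj).1 l (mem_filter.1 hl).1
    · have hπ : ∀ j ∈ A.filter fun j => ¬ π j ⊆ B, π j ⊆ C \ (X ∩ C) := by
        intro j hj x hx
        rw [mem_filter] at hj
        have := (h₁ j hj.1).1 hx
        have hxC := (hside j hj.1).resolve_left hj.2 hx
        simp only [mem_sdiff, mem_inter] at this ⊢
        exact ⟨hxC, fun h => this.2 h.1⟩
      have hserve : Serves G W D (C \ (X ∩ C)) (A.filter fun j => ¬ π j ⊆ B) :=
        ⟨π, fun j hj => ⟨hπ j hj, (h₁ j (mem_filter.1 hj).1).2⟩,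
          fun j hj l hl => h₂ j (mem_filter.1 hj).1 l (mem_filter.1 hl).1⟩
      by_cases hcX : c ∈ X
      · left
        refine ⟨X ∩ C, inter_subset_right, by simp [hcX, hc], ?_, le_rfl, hserve⟩
        refine hX.inter hcX hc fun x hx hxC y hy hyC hxy => ?_
        exact (hedge y (by simpa [hyC] using hXB hy) x hxC hxy.symm).2
      · right
        -- `X` contains `p`, and the only way from `p` into `C` is through `c`. Without `c` it has
        -- nothing in `C`, which is the alternative `k₂ = 0`.
        have hempty : X ∩ C = ∅ := by
          by_contra hne
          obtain ⟨y, hy⟩ := nonempty_iff_ne_empty.2 hne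
          rw [mem_inter] at hy
          obtain ⟨u, hu, w, hw, huB, hwB, huw⟩ := hX.exists_adj hpX hp hy.1 (hnot y hy.2)
          obtain ⟨-, rfl⟩ := hedge u huB w (by simpa [hwB] using hXB hw) huw
          exact hcX hw
        rw [hempty] at hserve ⊢
        exact ⟨by simp, hserve.mono sdiff_subset Subset.rfl⟩
  · rintro ⟨A₁, hA₁, A₂, hA₂, hA, -, k₁, k₂, hk, ⟨X, hXB, hpX, hX, hk₁, hs⟩, h | ⟨rfl, h⟩⟩
    · obtain ⟨Y, hYC, hcY, hY, hk₂, ht⟩ := h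
      have hXY : Disjoint X Y := disjoint_of_subset_left hXB (disjoint_of_subset_right hYC hBC)
      refine ⟨X ∪ Y, union_subset_union hXB hYC, by simp [hpX], hX.union hY hpX hcY hpc, ?_,
        (hs.union ht (disjoint_of_subset_left sdiff_subset
          (disjoint_of_subset_right sdiff_subset hBC))).mono ?_ hA⟩
      · rw [sum_union hXY]
        omega
      · intro x hx
        simp only [mem_union, mem_sdiff] at hx ⊢
        rcases hx with ⟨hx, hx'⟩ | ⟨hx, hx'⟩
        · exact ⟨Or.inl hx, fun h => h.elim hx' fun h => hnot x (hYC h) hx⟩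
        · exact ⟨Or.inr hx, fun h => h.elim (fun h => hnot x hx (hXB h)) hx'⟩
    · refine ⟨X, hXB.trans subset_union_left, hpX, hX, by omega,
        (hs.union h (disjoint_of_subset_left sdiff_subset hBC)).mono ?_ hA⟩
      intro x hx
      simp only [mem_union, mem_sdiff] at hx ⊢
      rcases hx with ⟨hx, hx'⟩ | hx
      · exact ⟨Or.inl hx, hx'⟩
      · exact ⟨Or.inr hx, fun h => hnot x hx (hXB h)⟩

/-- The bundle through `v` uses up the whole blob, and a player served by the empty remainder would
have weight `0 < D`. -/
theorem extends_singleton_iff (hD : 0 < D) (v : V) (A : Finset ℕ) (i k : ℕ) :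
    Extends G W D {v} v A i k ↔ A = ∅ ∧ k ≤ W i v := by
  constructor
  · rintro ⟨X, hX, hv, -, hk, π, h₁, -⟩
    obtain rfl : X = {v} := Subset.antisymm hX (by simpa using hv)
    refine ⟨eq_empty_iff_forall_notMem.2 fun j hj => ?_, by simpa using hk⟩
    have h := h₁ j hj
    have h0 : π j = ∅ := by simpa using h.1
    rw [h0, sum_empty] at h
    omega
  · rintro ⟨rfl, hk⟩
    exact ⟨{v}, Subset.rfl, by simp, conn_singleton v, by simpa using hk, serves_empty _⟩

/-! ### Elimination of leaves -/

variable (G) in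
/-- The blobs `B v` of the vertices `v` in `A` partition the graph, and `v` is the only vertex of
its blob with neighbours outside. -/
structure IsBlobs (A : Finset V) (B : V → Finset V) : Prop where
  mem : ∀ v ∈ A, v ∈ B v
  disjoint : ∀ u ∈ A, ∀ v ∈ A, u ≠ v → Disjoint (B u) (B v)
  cover : ∀ x, ∃ v ∈ A, x ∈ B v
  boundary : ∀ v ∈ A, ∀ x ∈ B v, ∀ y, y ∉ B v → G.Adj x y → x = v

/-- The boundary condition applies at both ends of the edge. This supplies the single-edge
hypothesis of `extends_union_iff`. -/
theorem IsBlobs.edge {A : Finset V} {B : V → Finset V} (h : IsBlobs G A B) {p c : V} (hp : p ∈ A)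
    (hc : c ∈ A) (hpc : p ≠ c) {x y : V} (hx : x ∈ B p) (hy : y ∈ B c) (hxy : G.Adj x y) :
    x = p ∧ y = c := by
  have hd := h.disjoint p hp c hc hpc
  exact ⟨h.boundary p hp x hx y (fun h => disjoint_left.1 hd h hy) hxy,
    h.boundary c hc y hy x (fun h => disjoint_left.1 hd hx h) hxy.symm⟩

/-- The critical condition is the boundary. An edge leaving the old blob of `c` and avoiding that of
`p` would run from `c` to the representative of a third blob; but the only surviving neighbour of
`c` is `p`. -/
theorem IsBlobs.merge {A : Finset V} {B : V → Finset V} (h : IsBlobs G A B) {p c : V}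
    (hp : p ∈ A) (hc : c ∈ A) (hpc : p ≠ c) (hleaf : ∀ w ∈ A, G.Adj c w → w = p) :
    IsBlobs G (A.erase c) (Function.update B p (B p ∪ B c)) where
  mem v hv := by
    rw [mem_erase] at hv
    by_cases hvp : v = p
    · subst hvp
      simp [h.mem v hp]
    · simp [hvp, h.mem v hv.2]
  disjoint u hu v hv huv := by
    rw [mem_erase] at hu hv
    by_cases hup : u = p
    · subst hup
      rw [Function.update_self, Function.update_of_ne huv.symm, disjoint_union_left]
      exact ⟨h.disjoint u hp v hv.2 huv, h.disjoint c hc v hv.2 hv.1.symm⟩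
    · by_cases hvp : v = p
      · subst hvp
        rw [Function.update_self, Function.update_of_ne huv, disjoint_union_right]
        exact ⟨h.disjoint u hu.2 v hp huv, h.disjoint u hu.2 c hc hu.1⟩
      · rw [Function.update_of_ne hup, Function.update_of_ne hvp]
        exact h.disjoint u hu.2 v hv.2 huv
  cover x := by
    obtain ⟨v, hv, hx⟩ := h.cover x
    by_cases hvc : v = c ∨ v = p
    · refine ⟨p, mem_erase.2 ⟨hpc, hp⟩, ?_⟩
      rw [Function.update_self, mem_union]
      rcases hvc with rfl | rfl
      · exact Or.inr hx
      · exact Or.inl hx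
    · push Not at hvc
      exact ⟨v, mem_erase.2 ⟨hvc.1, hv⟩, by rwa [Function.update_of_ne hvc.2]⟩
  boundary v hv x hx y hy hxy := by
    rw [mem_erase] at hv
    by_cases hvp : v = p
    · subst hvp
      rw [Function.update_self, mem_union] at hx hy
      push Not at hy
      rcases hx with hx | hx
      · exact h.boundary v hp x hx y hy.1 hxy
      · obtain rfl := h.boundary c hc x hx y hy.2 hxy
        obtain ⟨w, hw, hyw⟩ := h.cover y
        have hwx : w ≠ x := by
          rintro rfl
          exact hy.2 hyw
        obtain ⟨-, rfl⟩ := h.edge hc hw hwx.symm hx hyw hxy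
        obtain rfl := hleaf y hw hxy
        exact absurd hyw hy.1
    · rw [Function.update_of_ne hvp] at hx hy
      exact h.boundary v hv.2 x hx y hy hxy

theorem isBlobs_singleton [Fintype V] : IsBlobs G univ (fun v => {v}) where
  mem := by simp
  disjoint := by simp
  cover := by simp
  boundary v _ x hx _ _ _ := by simpa using hx

/-- The subgraph induced on `A` is connected and inherits acyclicity, so it is a tree with at least
two vertices and has a vertex of degree one. -/
theorem Conn.exists_leaf (hG : G.IsAcyclic) {A : Finset V} (hA : Conn G A) (h : 1 < #A) :
    ∃ c ∈ A, ∃! w, w ∈ A ∧ G.Adj c w := by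
  classical
  obtain ⟨x, hx, y, hy, hxy⟩ := one_lt_card.1 h
  have : Nontrivial (A : Set V) := ⟨⟨x, hx⟩, ⟨y, hy⟩, by simpa using hxy⟩
  have ht : (G.induce (A : Set V)).IsTree :=
    ⟨(SimpleGraph.connected_iff _).2 ⟨hA, ⟨x, hx⟩⟩, hG.induce _⟩
  obtain ⟨c, hc⟩ := ht.exists_vert_degree_one_of_nontrivial
  obtain ⟨w, hw, hu⟩ := SimpleGraph.degree_eq_one_iff_existsUnique_adj.1 hc
  refine ⟨c, c.2, w, ⟨w.2, by simpa using hw⟩, ?_⟩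
  rintro z ⟨hz, hcz⟩
  have := hu ⟨z, hz⟩ (by simpa using hcz)
  rw [← this]

/-- An instance of `Conn.inter`: every edge from the remaining vertices to `c` starts in `p`. -/
theorem Conn.erase_leaf {A : Finset V} (hA : Conn G A) {p c : V} (hp : p ∈ A) (hpc : p ≠ c)
    (hleaf : ∀ w ∈ A, G.Adj c w → w = p) : Conn G (A.erase c) := by
  have := hA.inter (B := A.erase c) hp (mem_erase.2 ⟨hpc, hp⟩) fun x hx _ y hy hyc hxy => by
    have : y = c := by simpa [hy] using hyc
    subst this
    exact hleaf x hx hxy.symm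
  rwa [inter_eq_right.2 (erase_subset c A)] at this

end ConnectedDivision

namespace RAM

/-! ### Derived expressions and rules for statements -/

namespace Ex

/-- The variable `x` does not occur. -/
def avoids (x : ℕ) : Ex → Bool
  | var y => y != x
  | lit _ => true
  | add e f => e.avoids x && f.avoids x
  | sub e f => e.avoids x && f.avoids x
  | mul e f => e.avoids x && f.avoids x
  | div e f => e.avoids x && f.avoids x
  | arr _ e => e.avoids x
  | ite c e f => c.avoids x && e.avoids x && f.avoids x
  | fold i a N e b => i != x && a != x && N.avoids x && e.avoids x && b.avoids x

/-- In a fold, `avoids` also forbids `x` as counter or accumulator, so the update of `x` commutes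
with those made by the loop. The main use is to show that the body of a derived loop does not see
the accumulator. -/
theorem eval_setv_of_avoids {x : ℕ} (y : ℕ) (e : Ex) : ∀ s : Env, e.avoids x = true →
    e.eval (s.setv x y) = e.eval s := by
  induction e with
  | fold i a N e b ihN ihe ihb =>
    intro s h
    simp only [avoids, Bool.and_eq_true, bne_iff_ne] at h
    obtain ⟨⟨⟨⟨hi, ha⟩, hN⟩, he⟩, hb⟩ := h
    simp only [eval, ihN s hN, ihe s he]
    congr 1
    funext j z
    rw [Env.setv_comm _ (Ne.symm hi), Env.setv_comm _ (Ne.symm ha), ihb _ hb]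
  | _ =>
    intro s h
    simp only [avoids, Bool.and_eq_true, bne_iff_ne] at h
    simp_all [eval]

theorem ok_setv_of_avoids {M x : ℕ} (y : ℕ) (e : Ex) : ∀ s : Env, e.avoids x = true →
    (e.Ok M (s.setv x y) ↔ e.Ok M s) := by
  induction e with
  | fold i a N e b ihN ihe ihb =>
    intro s h
    simp only [avoids, Bool.and_eq_true, bne_iff_ne] at h
    obtain ⟨⟨⟨⟨hi, ha⟩, hN⟩, he⟩, hb⟩ := h
    simp only [Ok, ihN s hN, ihe s he, eval_setv_of_avoids y N s hN]
    refine and_congr_right fun _ => and_congr_right fun _ => and_congr_right fun _ =>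
      forall_congr' fun j => forall_congr' fun _ => forall_congr' fun z => ?_
    rw [Env.setv_comm _ (Ne.symm hi), Env.setv_comm _ (Ne.symm ha), ihb _ hb]
  | mul e f ihe ihf =>
    intro s h
    simp only [avoids, Bool.and_eq_true] at h
    simp only [Ok, ihe s h.1, ihf s h.2, eval_setv_of_avoids y f s h.2]
  | _ =>
    intro s h
    simp only [avoids, Bool.and_eq_true, bne_iff_ne] at h
    simp_all [Ok]

def lt (e f : Ex) : Ex := ite (sub f e) (lit 1) (lit 0)

/-- Nonzero if and only if the values are different. -/
def ne (e f : Ex) : Ex := add (sub e f) (sub f e)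

def eq (e f : Ex) : Ex := ite (ne e f) (lit 0) (lit 1)

def mod (e f : Ex) : Ex := sub e (mul (div e f) f)

/-- Subtraction is truncated, so the second summand is the excess of `f` over `e`, if any. -/
def max (e f : Ex) : Ex := add e (sub f e)

def sumOver (i a : ℕ) (N b : Ex) : Ex := fold i a N (lit 0) (add (var a) b)

def maxOver (i a : ℕ) (N b : Ex) : Ex := fold i a N (lit 0) (max (var a) b)

/-- One if `b` has the value zero for all `i` below `N`, and zero otherwise. -/
def allZero (i a : ℕ) (N b : Ex) : Ex := fold i a N (lit 1) (ite b (lit 0) (var a))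

/-- Powers of two. -/
def pow (i a : ℕ) (N : Ex) : Ex := fold i a N (lit 1) (add (var a) (var a))

variable (s : Env) (M : ℕ)

theorem eval_lt (e f : Ex) : (lt e f).eval s = if e.eval s < f.eval s then 1 else 0 := by
  simp [lt, eval, Nat.sub_eq_zero_iff_le]

theorem eval_ne_eq_zero_iff (e f : Ex) : (ne e f).eval s = 0 ↔ e.eval s = f.eval s := by
  simp only [ne, eval]
  omega

theorem eval_eq (e f : Ex) : (eq e f).eval s = if e.eval s = f.eval s then 1 else 0 := by
  by_cases h : e.eval s = f.eval s
  · simp [eq, eval, (eval_ne_eq_zero_iff s e f).2 h, h]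
  · simp [eq, eval, mt (eval_ne_eq_zero_iff s e f).1 h, h]

theorem eval_mod (e f : Ex) : (mod e f).eval s = e.eval s % f.eval s := by
  simp only [mod, eval]
  have := Nat.div_add_mod' (e.eval s) (f.eval s)
  omega

theorem eval_max (e f : Ex) : (max e f).eval s = Max.max (e.eval s) (f.eval s) := by
  simp only [max, eval]
  omega

variable {s M} {i a : ℕ} {N b : Ex}

theorem eval_sumOver (h : b.avoids a = true) :
    (sumOver i a N b).eval s = ∑ j ∈ Finset.range (N.eval s), b.eval (s.setv i j) := by
  simp only [sumOver, eval]
  induction N.eval s with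
  | zero => rfl
  | succ n ih =>
    rw [iter, ih, Finset.sum_range_succ, eval_setv_of_avoids _ _ _ h]
    simp

theorem eval_maxOver (h : b.avoids a = true) :
    (maxOver i a N b).eval s = (Finset.range (N.eval s)).sup fun j => b.eval (s.setv i j) := by
  simp only [maxOver, eval, eval_max]
  induction N.eval s with
  | zero => rfl
  | succ n ih =>
    rw [iter, ih, Finset.range_add_one, Finset.sup_insert, eval_setv_of_avoids _ _ _ h]
    simp [max_comm]

theorem eval_allZero (h : b.avoids a = true) :
    (allZero i a N b).eval s = if ∀ j < N.eval s, b.eval (s.setv i j) = 0 then 1 else 0 := by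
  simp only [allZero, eval]
  induction N.eval s with
  | zero => rfl
  | succ n ih =>
    rw [iter, ih, eval_setv_of_avoids _ _ _ h]
    simp only [Nat.forall_lt_succ_right]
    by_cases hn : b.eval (s.setv i n) = 0 <;> simp [hn]

theorem eval_pow : (pow i a N).eval s = 2 ^ N.eval s := by
  simp only [pow, eval]
  induction N.eval s with
  | zero => rfl
  | succ n ih =>
    rw [iter, ih, pow_succ]
    simp
    omega

theorem ok_lt {e f : Ex} : (lt e f).Ok M s ↔ e.Ok M s ∧ f.Ok M s := by
  simp [lt, Ok, and_comm]

theorem ok_ne {e f : Ex} : (ne e f).Ok M s ↔ e.Ok M s ∧ f.Ok M s := by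
  simp [ne, Ok, and_comm]

theorem ok_eq {e f : Ex} : (eq e f).Ok M s ↔ e.Ok M s ∧ f.Ok M s := by
  simp [eq, Ok, ok_ne]

theorem ok_mod {e f : Ex} :
    (mod e f).Ok M s ↔ e.Ok M s ∧ f.Ok M s ∧ (f.eval s).size ≤ M := by
  simp only [mod, Ok]
  tauto

theorem ok_max {e f : Ex} : (max e f).Ok M s ↔ e.Ok M s ∧ f.Ok M s := by
  simp only [max, Ok]
  tauto

theorem ok_sumOver (h : b.avoids a = true) : (sumOver i a N b).Ok M s ↔
    N.Ok M s ∧ N.eval s ≤ M ∧ ∀ j < N.eval s, b.Ok M (s.setv i j) := by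
  simp [sumOver, Ok, ok_setv_of_avoids _ _ _ h]

theorem ok_maxOver (h : b.avoids a = true) : (maxOver i a N b).Ok M s ↔
    N.Ok M s ∧ N.eval s ≤ M ∧ ∀ j < N.eval s, b.Ok M (s.setv i j) := by
  simp [maxOver, Ok, ok_max, ok_setv_of_avoids _ _ _ h]

theorem ok_allZero (h : b.avoids a = true) : (allZero i a N b).Ok M s ↔
    N.Ok M s ∧ N.eval s ≤ M ∧ ∀ j < N.eval s, b.Ok M (s.setv i j) := by
  simp [allZero, Ok, ok_setv_of_avoids _ _ _ h]

theorem ok_pow : (pow i a N).Ok M s ↔ N.Ok M s ∧ N.eval s ≤ M := by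
  simp [pow, Ok]

end Ex

namespace Stmt

/-- The statement runs within the bound `M`, and the result satisfies `Q`. -/
def Spec (M : ℕ) (p : Stmt) (s : Env) (Q : Env → Prop) : Prop := p.Ok M s ∧ Q (p.eval s)

variable {M : ℕ} {s : Env} {Q : Env → Prop}

theorem spec_assign {x : ℕ} {e : Ex} (h : e.Ok M s) (hQ : Q (s.setv x (e.eval s))) :
    (assign x e).Spec M s Q := ⟨h, hQ⟩

theorem spec_write {k : Fin 14} {e f : Ex} (he : e.Ok M s) (hf : f.Ok M s)
    (hQ : Q (s.seta k (Function.update (s.a k) (e.eval s) (f.eval s)))) :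
    (write k e f).Spec M s Q := ⟨⟨he, hf⟩, hQ⟩

theorem spec_read {x : ℕ} (h : (s.inp.headD 0).size ≤ M)
    (hQ : Q (s.pop x)) : (read x).Spec M s Q := ⟨h, hQ⟩

theorem spec_seq {p q : Stmt} (h : p.Spec M s fun t => q.Spec M t Q) :
    (seq p q).Spec M s Q := ⟨⟨h.1, h.2.1⟩, h.2.2⟩

theorem Spec.mono {p : Stmt} {R : Env → Prop} (h : p.Spec M s R) (hR : ∀ t, R t → Q t) :
    p.Spec M s Q := ⟨h.1, hR _ h.2⟩

/-- The rule for loops with an invariant. -/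
theorem spec_for {i : ℕ} {N : Ex} {b : Stmt} (Inv : ℕ → Env → Prop) (hN : N.Ok M s)
    (hM : N.eval s ≤ M) (h₀ : Inv 0 s)
    (hstep : ∀ j < N.eval s, ∀ t, Inv j t → b.Spec M (t.setv i j) (Inv (j + 1)))
    (hQ : ∀ t, Inv (N.eval s) t → Q (t.setv i (s.v i))) : (Stmt.for i N b).Spec M s Q := by
  have key : ∀ n ≤ N.eval s, Inv n (iter (fun j s => b.eval (s.setv i j)) n s) := by
    intro n hn
    induction n with
    | zero => exact h₀
    | succ n ih => exact (hstep n (by omega) _ (ih (by omega))).2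
  exact ⟨⟨hN, hM, fun j hj => (hstep j hj _ (key j hj.le)).1⟩, hQ _ (key _ le_rfl)⟩

/-- Fill the cells `off + j` of an array, for `j` below `N`, with the values of `f`. -/
def tabulate (k : Fin 14) (off : Ex) (i : ℕ) (N f : Ex) : Stmt :=
  .for i N (write k (.add off (.var i)) f)

/-- The hypotheses on `off` and `f` hold for every content `h` of the array being filled: the
computed values must not depend on cells written earlier in the same loop. The invariant leaves the
counter arbitrary, because the loop restores it at the end. -/
theorem spec_tabulate {k : Fin 14} {off : Ex} {i : ℕ} {N f : Ex} {o : ℕ} {g : ℕ → ℕ}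
    (hN : N.Ok M s) (hM : N.eval s ≤ M)
    (hoff : ∀ j < N.eval s, ∀ h, off.Ok M ((s.seta k h).setv i j) ∧
      off.eval ((s.seta k h).setv i j) = o)
    (hf : ∀ j < N.eval s, ∀ h, f.Ok M ((s.seta k h).setv i j) ∧
      f.eval ((s.seta k h).setv i j) = g j)
    (hQ : Q (s.seta k fun x => if o ≤ x ∧ x < o + N.eval s then g (x - o) else s.a k x)) :
    (tabulate k off i N f).Spec M s Q := by
  refine spec_for (fun j t => ∃ y, t = (s.seta k fun x =>
    if o ≤ x ∧ x < o + j then g (x - o) else s.a k x).setv i y) hN hM ?_ ?_ ?_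
  · refine ⟨s.v i, ?_⟩
    have : (fun x => if o ≤ x ∧ x < o + 0 then g (x - o) else s.a k x) = s.a k := by
      funext x
      rw [if_neg (by omega)]
    rw [this]
    simp
  · rintro j hj t ⟨y, rfl⟩
    rw [Env.setv_setv]
    refine spec_write ⟨(hoff j hj _).1, trivial⟩ (hf j hj _).1 ⟨j, ?_⟩
    rw [(hf j hj _).2, Env.setv_seta, Env.setv_a, Env.seta_a, Env.seta_seta,
      Function.update_self]
    congr 2
    funext x
    simp only [Ex.eval, (hoff j hj _).2, Function.update_apply, Env.setv_v, if_true]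
    by_cases hx : x = o + j
    · rw [if_pos hx, if_pos (by omega), hx, Nat.add_sub_cancel_left]
    · rw [if_neg hx]
      exact if_congr (by omega) rfl rfl
  · rintro t ⟨y, rfl⟩
    rw [Env.setv_setv]
    convert hQ using 1
    exact Env.setv_self _ i

end Stmt
end RAM

namespace ConnectedDivision

/-! ### Tables indexed by codes of sets of players -/

open Finset

/-- The binary digit of `S` at position `j`. -/
def bit (S j : ℕ) : ℕ := S / 2 ^ j % 2

/-- The players below `n` that are coded by `S`. -/
def players (n S : ℕ) : Finset ℕ := {j ∈ range n | bit S j = 1}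

theorem bit_lt_two (S j : ℕ) : bit S j < 2 := Nat.mod_lt _ two_pos

theorem mem_players {n S j : ℕ} : j ∈ players n S ↔ j < n ∧ bit S j = 1 := by
  simp [players]

theorem players_subset (n S : ℕ) : players n S ⊆ range n := filter_subset _ _

theorem exists_players_eq {n : ℕ} {A : Finset ℕ} (hA : A ⊆ range n) :
    ∃ S < 2 ^ n, players n S = A := by
  refine ⟨Nat.ofBits fun j : Fin n => decide ((j : ℕ) ∈ A), Nat.ofBits_lt_two_pow _, ?_⟩
  ext j
  rw [mem_players]
  constructor
  · rintro ⟨hj, h⟩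
    have := Nat.testBit_ofBits_lt (fun j : Fin n => decide ((j : ℕ) ∈ A)) j hj
    rw [Nat.testBit_eq_decide_div_mod_eq] at this
    simpa [bit] using this.symm.trans (decide_eq_true h)
  · intro h
    have hj := mem_range.1 (hA h)
    have := Nat.testBit_ofBits_lt (fun j : Fin n => decide ((j : ℕ) ∈ A)) j hj
    rw [Nat.testBit_eq_decide_div_mod_eq] at this
    exact ⟨hj, by simpa [bit, h] using this⟩

theorem players_eq_empty_iff {n S : ℕ} (hS : S < 2 ^ n) : players n S = ∅ ↔ S = 0 := by
  constructor
  · intro h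
    refine Nat.eq_of_testBit_eq fun j => ?_
    rw [Nat.zero_testBit, Nat.testBit_eq_decide_div_mod_eq, decide_eq_false_iff_not]
    intro hj
    by_cases hjn : j < n
    · have : j ∈ players n S := mem_players.2 ⟨hjn, hj⟩
      simp [h] at this
    · have : S / 2 ^ j = 0 :=
        Nat.div_eq_of_lt (hS.trans_le (Nat.pow_le_pow_right two_pos (by omega)))
      simp [this] at hj
  · rintro rfl
    ext j
    simp [mem_players, bit]

theorem players_pred_two_pow (n : ℕ) : players n (2 ^ n - 1) = range n := by
  ext j
  rw [mem_players, mem_range, and_iff_left_iff_imp]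
  intro hj
  have := Nat.testBit_two_pow_sub_one n j
  rw [Nat.testBit_eq_decide_div_mod_eq] at this
  simpa [bit, hj] using this

/-- The set coded by `S` is the disjoint union of those coded by `S₁` and `S₂`. -/
theorem forall_bit_eq_add_iff {n S S₁ S₂ : ℕ} :
    (∀ j < n, bit S j = bit S₁ j + bit S₂ j) ↔
      players n S₁ ⊆ players n S ∧ players n S₂ ⊆ players n S ∧
        players n S ⊆ players n S₁ ∪ players n S₂ ∧ Disjoint (players n S₁) (players n S₂) := by
  simp only [subset_iff, disjoint_left, mem_union, mem_players]
  constructor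
  · intro h
    refine ⟨?_, ?_, ?_, ?_⟩ <;>
    · rintro j ⟨hj, h'⟩
      have := h j hj
      have := bit_lt_two S j
      have := bit_lt_two S₁ j
      have := bit_lt_two S₂ j
      simp only [hj, true_and]
      omega
  · rintro ⟨h₁, h₂, h₃, h₄⟩ j hj
    have a₁ := @h₁ j
    have a₂ := @h₂ j
    have a₃ := @h₃ j
    have a₄ := @h₄ j
    simp only [hj, true_and] at a₁ a₂ a₃ a₄
    have := bit_lt_two S j
    have := bit_lt_two S₁ j
    have := bit_lt_two S₂ j
    omega

/-- The set coded by `S` is the disjoint union of the one coded by `S₁` and `{i}`. -/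
theorem forall_bit_eq_add_ite_iff {n S S₁ i : ℕ} :
    (∀ j < n, bit S j = bit S₁ j + if j = i then 1 else 0) ↔
      (∀ j < n, j ∈ players n S ↔ j ∈ players n S₁ ∨ j = i) ∧ i ∉ players n S₁ := by
  simp only [mem_players]
  constructor
  · intro h
    refine ⟨fun j hj => ?_, ?_⟩
    · have := h j hj
      have := bit_lt_two S j
      have := bit_lt_two S₁ j
      simp only [hj, true_and]
      split_ifs at * <;> omega
    · rintro ⟨hi, h'⟩
      have := h i hi
      have := bit_lt_two S i
      simp only [if_true] at *
      omega
  · rintro ⟨h₁, h₂⟩ j hj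
    have := h₁ j hj
    simp only [hj, true_and] at this
    have := bit_lt_two S j
    have := bit_lt_two S₁ j
    split_ifs with hji
    · subst hji
      simp only [hj, true_and] at h₂
      omega
    · omega

variable {V : Type*} [DecidableEq V] {G : SimpleGraph V} {W : ℕ → V → ℕ} {D n : ℕ}

variable (G W D n) in
/-- The numbers `t S i` are one more than the greatest weight for `i` of a bundle at `v` in `B`
that leaves enough for the players coded by `S`, or zero if there is none. -/
def IsTable (B : Finset V) (v : V) (t : ℕ → ℕ → ℕ) : Prop :=
  ∀ S < 2 ^ n, ∀ i < n + 1, ∀ k, k < t S i ↔ Extends G W D B v (players n S) i k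

/-- Whether the players coded by `S` can be served, computed from a table. -/
def served (D n : ℕ) (t : ℕ → ℕ → ℕ) (S : ℕ) : ℕ :=
  (range (n + 1)).sup fun i => (range (2 ^ n)).sup fun S₁ =>
    if ∀ j < n, bit S j = bit S₁ j + if j = i then 1 else 0 then
      if D < t S₁ i then 1 else 0 else 0

/-- Sum of two table entries. -/
def joined (a b : ℕ) : ℕ := if a ≠ 0 then if b ≠ 0 then a + b - 1 else 0 else 0

/-- The table of a part that has been joined with the part of a leaf. -/
def mergeTable (n : ℕ) (t t' : ℕ → ℕ → ℕ) (e : ℕ → ℕ) (S i : ℕ) : ℕ :=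
  (range (2 ^ n)).sup fun S₁ => (range (2 ^ n)).sup fun S₂ =>
    if ∀ j < n, bit S j = bit S₁ j + bit S₂ j then joined (t S₁ i) (max (t' S₂ i) (e S₂)) else 0

/-- This is why tables are described by `k < t S i`: maxima become existential quantifiers, and an
infeasible entry is `0`, below which there is no `k`. -/
theorem lt_sup_range_iff {N k : ℕ} {f : ℕ → ℕ} :
    k < (range N).sup f ↔ ∃ j < N, k < f j := by
  simp [Finset.lt_sup_iff]

/-- Nonzero entries are maxima plus one, so one of the two extra units has to be subtracted from the
sum; a zero entry makes the sum infeasible. -/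
theorem lt_joined_iff {a b k : ℕ} : k < joined a b ↔ ∃ k₁ k₂, k ≤ k₁ + k₂ ∧ k₁ < a ∧ k₂ < b := by
  unfold joined
  split_ifs with ha hb
  · constructor
    · intro h
      exact ⟨a - 1, b - 1, by omega, by omega, by omega⟩
    · rintro ⟨k₁, k₂, h⟩
      omega
  · constructor
    · omega
    · rintro ⟨k₁, k₂, h⟩
      omega
  · constructor
    · omega
    · rintro ⟨k₁, k₂, h⟩
      omega

/-- The value is at most one, hence the condition `k = 0`. In this form it is the second alternative
for the leaf in `extends_union_iff`, so a maximum with the table entry expresses the disjunction. -/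
theorem lt_served_iff {B : Finset V} {v : V} {t : ℕ → ℕ → ℕ} (ht : IsTable G W D n B v t)
    (hv : v ∈ B) (hn : ∀ v, W n v = D) (S k : ℕ) :
    k < served D n t S ↔ k = 0 ∧ Serves G W D B (players n S) := by
  rw [serves_iff_exists_extends hv (players_subset n S) hn, served, lt_sup_range_iff]
  simp only [lt_sup_range_iff]
  constructor
  · rintro ⟨i, hi, S₁, hS₁, h⟩
    split_ifs at h with h₁ h₂
    · refine ⟨by omega, i, hi, players n S₁, players_subset _ _, ?_, ?_,
        (ht S₁ hS₁ i hi D).1 h₂⟩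
      · exact (forall_bit_eq_add_ite_iff.1 h₁).1
      · exact (forall_bit_eq_add_ite_iff.1 h₁).2
    · omega
    · omega
  · rintro ⟨rfl, i, hi, A, hA, h₁, h₂, h⟩
    obtain ⟨S₁, hS₁, rfl⟩ := exists_players_eq hA
    refine ⟨i, hi, S₁, hS₁, ?_⟩
    rw [if_pos (forall_bit_eq_add_ite_iff.2 ⟨h₁, h₂⟩), if_pos ((ht S₁ hS₁ i hi D).2 h)]
    exact one_pos

/-- With thresholds in place of maxima, this is `extends_union_iff` read through codes:
`exists_players_eq` codes the two sets, and `forall_bit_eq_add_iff` turns disjoint union into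
digitwise addition without carry. -/
theorem IsTable.merge {B C : Finset V} {p c : V} {t t' : ℕ → ℕ → ℕ}
    (ht : IsTable G W D n B p t) (ht' : IsTable G W D n C c t') (hn : ∀ v, W n v = D)
    (hBC : Disjoint B C) (hp : p ∈ B) (hc : c ∈ C) (hpc : G.Adj p c)
    (hedge : ∀ x ∈ B, ∀ y ∈ C, G.Adj x y → x = p ∧ y = c) :
    IsTable G W D n (B ∪ C) p (mergeTable n t t' (served D n t')) := by
  intro S hS i hi k
  rw [extends_union_iff hBC hp hc hpc hedge, mergeTable, lt_sup_range_iff]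
  simp only [lt_sup_range_iff]
  constructor
  · rintro ⟨S₁, hS₁, S₂, hS₂, h⟩
    split_ifs at h with h₁
    · obtain ⟨k₁, k₂, hk, hk₁, hk₂⟩ := lt_joined_iff.1 h
      obtain ⟨b₁, b₂, b₃, b₄⟩ := forall_bit_eq_add_iff.1 h₁
      refine ⟨_, b₁, _, b₂, b₃, b₄, k₁, k₂, hk, (ht S₁ hS₁ i hi k₁).1 hk₁, ?_⟩
      rcases lt_max_iff.1 hk₂ with h' | h'
      · exact Or.inl ((ht' S₂ hS₂ i hi k₂).1 h')
      · exact Or.inr ((lt_served_iff ht' hc hn S₂ k₂).1 h')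
    · omega
  · rintro ⟨A₁, hA₁, A₂, hA₂, hA, hd, k₁, k₂, hk, h₁, h₂⟩
    obtain ⟨S₁, hS₁, rfl⟩ := exists_players_eq (hA₁.trans (players_subset n S))
    obtain ⟨S₂, hS₂, rfl⟩ := exists_players_eq (hA₂.trans (players_subset n S))
    refine ⟨S₁, hS₁, S₂, hS₂, ?_⟩
    rw [if_pos (forall_bit_eq_add_iff.2 ⟨hA₁, hA₂, hA, hd⟩)]
    refine lt_joined_iff.2 ⟨k₁, k₂, hk, (ht S₁ hS₁ i hi k₁).2 h₁, lt_max_iff.2 ?_⟩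
    rcases h₂ with h₂ | h₂
    · exact Or.inl ((ht' S₂ hS₂ i hi k₂).2 h₂)
    · exact Or.inr ((lt_served_iff ht' hc hn S₂ k₂).2 h₂)

theorem isTable_singleton (hD : 0 < D) (v : V) :
    IsTable G W D n {v} v fun S i => if S ≠ 0 then 0 else W i v + 1 := by
  intro S hS i _ k
  rw [extends_singleton_iff hD, players_eq_empty_iff hS]
  by_cases h : S = 0
  · simp [h]
  · simp [h]

end ConnectedDivision

namespace TreeSolver

/-! ### The program -/

open RAM RAM.Ex RAM.Stmt ConnectedDivision

local notation "xN" => 1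
local notation "xM" => 2
local notation "xP" => 3
local notation "xQ" => 4
local notation "xD" => 5
local notation "xIn" => 6
local notation "xC" => 7
local notation "xR" => 8
local notation "xJ" => 9
local notation "xK" => 10
local notation "aAdj" => 0
local notation "aNum" => 1
local notation "aDen" => 2
local notation "aW" => 3
local notation "aAlive" => 4
local notation "aT" => 5
local notation "aE" => 6
local notation "aU" => 7

def bitE (S j : Ex) : Ex := mod (div S (pow 11 12 j)) (lit 2)

def splitE (S S₁ S₂ : Ex) : Ex :=
  allZero 13 14 (var xN)
    (ne (bitE S (var 13)) (add (bitE S₁ (var 13)) (bitE S₂ (var 13))))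

def splitOneE (S S₁ i : Ex) : Ex :=
  allZero 13 14 (var xN) (ne (bitE S (var 13)) (add (bitE S₁ (var 13)) (eq (var 13) i)))

def tableE (v S i : Ex) : Ex := arr aT (add (mul (add (mul v (var xP)) S) (var xQ)) i)

/-- Whether the set coded by `S` can be served at `v`. -/
def servedE (v S : Ex) : Ex :=
  maxOver 19 20 (var xQ) <| maxOver 15 16 (var xP) <|
    ite (splitOneE S (var 15) (var 19)) (lt (var xD) (tableE v (var 15) (var 19))) (lit 0)

def joinedE (e f : Ex) : Ex := ite e (ite f (sub (add e f) (lit 1)) (lit 0)) (lit 0)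

/-- The entry with index `xJ` of the table of `xR` joined with `xC`. -/
def mergeE : Ex :=
  maxOver 15 16 (var xP) <| maxOver 17 18 (var xP) <|
    ite (splitE (div (var xJ) (var xQ)) (var 15) (var 17))
      (joinedE (tableE (var xR) (var 15) (mod (var xJ) (var xQ)))
        (max (tableE (var xC) (var 17) (mod (var xJ) (var xQ))) (arr aE (var 17)))) (lit 0)

def adjE (v w : Ex) : Ex := arr aAdj (add (mul v (var xM)) w)

/-- One more than the last vertex with exactly one neighbour that is left. -/
def leafE : Ex :=
  maxOver 21 22 (var xM) <|
    ite (arr aAlive (var 21))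
      (ite (eq (sumOver 23 24 (var xM)
        (ite (arr aAlive (var 23)) (adjE (var 21) (var 23)) (lit 0))) (lit 1))
        (add (var 21) (lit 1)) (lit 0)) (lit 0)

/-- The sum of the neighbours of `xC` that are left. -/
def parentE : Ex :=
  sumOver 23 24 (var xM)
    (ite (arr aAlive (var 23)) (ite (adjE (var xC) (var 23)) (var 23) (lit 0)) (lit 0))

/-- One more than the last vertex that is left. -/
def rootE : Ex :=
  maxOver 21 22 (var xM) (ite (arr aAlive (var 21)) (add (var 21) (lit 1)) (lit 0))

/-- Remove a leaf and join its part with that of its neighbour. -/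
def eliminate : Stmt :=
  seq (assign xC (sub leafE (lit 1))) <|
  seq (assign xR parentE) <|
  seq (tabulate aE (lit 0) xJ (var xP) (servedE (var xC) (var xJ))) <|
  seq (tabulate aU (lit 0) xJ (mul (var xP) (var xQ)) mergeE) <|
  seq (tabulate aT (mul (mul (var xR) (var xP)) (var xQ)) xJ (mul (var xP) (var xQ))
    (arr aU (var xJ))) <|
  write aAlive (var xC) (lit 0)

def readGraph : Stmt :=
  .for xJ (mul (var xM) (var xM)) (seq (read xIn) (write aAdj (var xJ) (var xIn)))

/-- Read the utilities and compute the product of the denominators. -/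
def readUtils : Stmt :=
  .for xJ (mul (var xN) (var xM)) <|
    seq (read xIn) <| seq (write aNum (var xJ) (var xIn)) <|
    seq (read xIn) <| seq (write aDen (var xJ) (var xIn)) <|
    assign xD (mul (var xD) (var xIn))

/-- The division is exact on the input, because `xD` is a multiple of each denominator. The order of
the factors matters for the cost: the long quotient is a first factor, while the second factors are
an input number and the number of players. Indices from `xN * xM` on form the row of the dummy
player. -/
def weightE : Ex :=
  ite (lt (var xJ) (mul (var xN) (var xM)))
    (mul (mul (div (var xD) (arr aDen (var xJ))) (arr aNum (var xJ))) (var xN)) (var xD)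

/-- The index `xJ` decodes as `(v * 2 ^ n + S) * (n + 1) + i`. In a one-vertex blob only the code `S
= 0` of the empty set is feasible. -/
def startE : Ex :=
  ite (mod (div (var xJ) (var xQ)) (var xP)) (lit 0)
    (add (arr aW (add (mul (mod (var xJ) (var xQ)) (var xM))
      (div (div (var xJ) (var xQ)) (var xP)))) (lit 1))

/-- After `xM - 1` eliminations one vertex is left, and its table is queried at `xP - 1`, the code
of the set of all players. -/
def solver : Stmt :=
  seq (read xN) <| seq (read xM) <| seq readGraph <| seq (assign xD (lit 1)) <| seq readUtils <|
  seq (assign xP (pow 11 12 (var xN))) <| seq (assign xQ (add (var xN) (lit 1))) <|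
  seq (tabulate aW (lit 0) xJ (mul (var xQ) (var xM)) weightE) <|
  seq (tabulate aAlive (lit 0) xJ (var xM) (lit 1)) <|
  seq (tabulate aT (lit 0) xJ (mul (mul (var xM) (var xP)) (var xQ)) startE) <|
  seq (.for xK (sub (var xM) (lit 1)) eliminate) <|
  seq (assign xC (sub rootE (lit 1))) <|
  seq (assign xJ (sub (var xP) (lit 1))) <|
  assign 0 (servedE (var xC) (var xJ))

/-! ### Values of the expressions -/

variable {s : Env} {M : ℕ}

theorem eval_bitE (S j : Ex) : (bitE S j).eval s = bit (S.eval s) (j.eval s) := by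
  simp [bitE, eval_mod, Ex.eval, eval_pow, bit]

theorem ok_bitE {S j : Ex} (hM : 2 ≤ M) :
    (bitE S j).Ok M s ↔ S.Ok M s ∧ j.Ok M s ∧ j.eval s ≤ M := by
  have : Nat.size 2 = 2 := by decide
  simp [bitE, ok_mod, Ex.Ok, ok_pow, Ex.eval, this, hM]

theorem eval_splitE {S S₁ S₂ : Ex}
    (h : (S.avoids 13 && S₁.avoids 13 && S₂.avoids 13 &&
      S.avoids 14 && S₁.avoids 14 && S₂.avoids 14) = true) :
    (splitE S S₁ S₂).eval s = if ∀ j < s.v xN,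
      bit (S.eval s) j = bit (S₁.eval s) j + bit (S₂.eval s) j then 1 else 0 := by
  simp only [Bool.and_eq_true] at h
  obtain ⟨⟨⟨⟨⟨h₁, h₂⟩, h₃⟩, h₄⟩, h₅⟩, h₆⟩ := h
  rw [splitE, eval_allZero]
  · simp only [eval_ne_eq_zero_iff, Ex.eval, eval_bitE, eval_setv_of_avoids _ _ _ h₁,
      eval_setv_of_avoids _ _ _ h₂, eval_setv_of_avoids _ _ _ h₃, Env.setv_v,
      Function.update_self]
  · simp [avoids, ne, bitE, mod, pow, h₄, h₅, h₆]

theorem ok_splitE {S S₁ S₂ : Ex} (hM : 2 ≤ M) (hn : s.v xN ≤ M)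
    (h : (S.avoids 13 && S₁.avoids 13 && S₂.avoids 13 &&
      S.avoids 14 && S₁.avoids 14 && S₂.avoids 14) = true)
    (hS : S.Ok M s) (hS₁ : S₁.Ok M s) (hS₂ : S₂.Ok M s) : (splitE S S₁ S₂).Ok M s := by
  simp only [Bool.and_eq_true] at h
  obtain ⟨⟨⟨⟨⟨h₁, h₂⟩, h₃⟩, h₄⟩, h₅⟩, h₆⟩ := h
  rw [splitE, ok_allZero]
  · simp only [ok_ne, Ex.Ok, Ex.eval, ok_bitE hM, ok_setv_of_avoids _ _ _ h₁,
      ok_setv_of_avoids _ _ _ h₂, ok_setv_of_avoids _ _ _ h₃, Env.setv_v,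
      Function.update_self, hS, hS₁, hS₂, true_and]
    exact ⟨hn, fun j hj => by omega⟩
  · simp [avoids, ne, bitE, mod, pow, h₄, h₅, h₆]

theorem eval_splitOneE {S S₁ i : Ex}
    (h : (S.avoids 13 && S₁.avoids 13 && i.avoids 13 &&
      S.avoids 14 && S₁.avoids 14 && i.avoids 14) = true) :
    (splitOneE S S₁ i).eval s = if ∀ j < s.v xN,
      bit (S.eval s) j = bit (S₁.eval s) j + (if j = i.eval s then 1 else 0) then 1 else 0 := by
  simp only [Bool.and_eq_true] at h
  obtain ⟨⟨⟨⟨⟨h₁, h₂⟩, h₃⟩, h₄⟩, h₅⟩, h₆⟩ := h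
  rw [splitOneE, eval_allZero]
  · simp only [eval_ne_eq_zero_iff, Ex.eval, eval_bitE, eval_eq, eval_setv_of_avoids _ _ _ h₁,
      eval_setv_of_avoids _ _ _ h₂, eval_setv_of_avoids _ _ _ h₃, Env.setv_v,
      Function.update_self]
  · simp [avoids, ne, eq, bitE, mod, pow, h₄, h₅, h₆]

theorem ok_splitOneE {S S₁ i : Ex} (hM : 2 ≤ M) (hn : s.v xN ≤ M)
    (h : (S.avoids 13 && S₁.avoids 13 && i.avoids 13 &&
      S.avoids 14 && S₁.avoids 14 && i.avoids 14) = true)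
    (hS : S.Ok M s) (hS₁ : S₁.Ok M s) (hi : i.Ok M s) : (splitOneE S S₁ i).Ok M s := by
  simp only [Bool.and_eq_true] at h
  obtain ⟨⟨⟨⟨⟨h₁, h₂⟩, h₃⟩, h₄⟩, h₅⟩, h₆⟩ := h
  rw [splitOneE, ok_allZero]
  · simp only [ok_ne, ok_eq, Ex.Ok, Ex.eval, ok_bitE hM, ok_setv_of_avoids _ _ _ h₁,
      ok_setv_of_avoids _ _ _ h₂, ok_setv_of_avoids _ _ _ h₃, Env.setv_v,
      Function.update_self, hS, hS₁, hi, true_and, and_true]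
    exact ⟨hn, fun j hj => by omega⟩
  · simp [avoids, ne, eq, bitE, mod, pow, h₄, h₅, h₆]

/-- The table of the vertex `v` in the memory. -/
def table (n : ℕ) (g : ℕ → ℕ) (v S i : ℕ) : ℕ := g ((v * 2 ^ n + S) * (n + 1) + i)

/-- The bound `M` is large enough for the parameters `n` and `m`. -/
structure Enough (M n m : ℕ) : Prop where
  two : 2 ≤ M
  pow : 2 ^ n * (n + 1) ≤ M
  items : m * m ≤ M
  entries : m * 2 ^ n * (n + 1) ≤ M

/-- The sizes are in their variables. -/
structure Params (n m D : ℕ) (s : Env) : Prop where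
  hn : s.v xN = n
  hm : s.v xM = m
  hP : s.v xP = 2 ^ n
  hQ : s.v xQ = n + 1
  hD : s.v xD = D

theorem Enough.le {n m : ℕ} (h : Enough M n m) :
    n ≤ M ∧ n + 1 ≤ M ∧ 2 ^ n ≤ M ∧ m ≤ M ∧ (n + 1) * m ≤ M ∧ n * m ≤ M := by
  have h₁ := h.pow
  have h₂ := h.items
  have h₃ := h.entries
  have h₄ : 1 ≤ 2 ^ n := Nat.one_le_two_pow
  refine ⟨by nlinarith, by nlinarith, by nlinarith, by nlinarith, ?_, ?_⟩
  · calc (n + 1) * m = m * 1 * (n + 1) := by ring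
      _ ≤ m * 2 ^ n * (n + 1) := by gcongr
      _ ≤ M := h₃
  · calc n * m = m * 1 * n := by ring
      _ ≤ m * 2 ^ n * (n + 1) := by gcongr; omega
      _ ≤ M := h₃

theorem size_le_of_le {x : ℕ} (h : x ≤ M) : x.size ≤ M := (size_le_self x).trans h

variable {n m D : ℕ}

theorem eval_servedE_var (hs : Params n m D s) :
    (servedE (var xC) (var xJ)).eval s =
      served D n (table n (s.a aT) (s.v xC)) (s.v xJ) := by
  simp +decide [servedE, eval_maxOver, Ex.eval, eval_splitOneE, tableE, eval_lt, served, table,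
    hs.hn, hs.hP, hs.hQ, hs.hD]
  congr!

theorem ok_servedE_var (hM : Enough M n m) (hs : Params n m D s) :
    (servedE (var xC) (var xJ)).Ok M s := by
  have := hM.le
  simp +decide [servedE, ok_maxOver, Ex.eval, Ex.Ok, tableE, ok_lt,
    hs.hP, hs.hQ, this, size_le_of_le]
  intro i _ S _
  exact ok_splitOneE hM.two (by simpa [hs.hn] using this.1) rfl trivial trivial trivial

theorem eval_mergeE (hs : Params n m D s) :
    mergeE.eval s = mergeTable n (table n (s.a aT) (s.v xR)) (table n (s.a aT) (s.v xC)) (s.a aE)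
      (s.v xJ / (n + 1)) (s.v xJ % (n + 1)) := by
  simp +decide [mergeE, eval_maxOver, Ex.eval, eval_splitE, tableE, eval_max, eval_mod, joinedE,
    joined, mergeTable, table, hs.hn, hs.hP, hs.hQ]

theorem ok_mergeE (hM : Enough M n m) (hs : Params n m D s) : mergeE.Ok M s := by
  have := hM.le
  simp +decide [mergeE, ok_maxOver, Ex.eval, Ex.Ok, tableE, ok_max, ok_mod, joinedE,
    hs.hP, hs.hQ, this, size_le_of_le]
  intro S₁ _ S₂ _
  exact ok_splitE hM.two (by simpa [hs.hn] using this.1) rfl ⟨trivial, trivial⟩ trivial trivial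

theorem eval_leafE (hs : Params n m D s) :
    leafE.eval s = (Finset.range m).sup fun v => if s.a aAlive v ≠ 0 then
      if ∑ w ∈ Finset.range m, (if s.a aAlive w ≠ 0 then s.a aAdj (v * m + w) else 0) = 1 then
        v + 1 else 0 else 0 := by
  simp +decide [leafE, eval_maxOver, eval_sumOver, Ex.eval, adjE, eval_eq, hs.hm]

theorem ok_leafE (hM : Enough M n m) (hs : Params n m D s) : leafE.Ok M s := by
  have := hM.le
  simp +decide [leafE, ok_maxOver, ok_sumOver, Ex.eval, Ex.Ok, adjE, ok_eq, hs.hm, this,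
    size_le_of_le]

theorem eval_parentE (hs : Params n m D s) :
    parentE.eval s = ∑ w ∈ Finset.range m, if s.a aAlive w ≠ 0 then
      if s.a aAdj (s.v xC * m + w) ≠ 0 then w else 0 else 0 := by
  simp +decide [parentE, eval_sumOver, Ex.eval, adjE, hs.hm]

theorem ok_parentE (hM : Enough M n m) (hs : Params n m D s) : parentE.Ok M s := by
  have := hM.le
  simp +decide [parentE, ok_sumOver, Ex.eval, Ex.Ok, adjE, hs.hm, this, size_le_of_le]

theorem eval_rootE (hs : Params n m D s) :
    rootE.eval s = (Finset.range m).sup fun v => if s.a aAlive v ≠ 0 then v + 1 else 0 := by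
  simp +decide [rootE, eval_maxOver, Ex.eval, hs.hm]

theorem ok_rootE (hM : Enough M n m) (hs : Params n m D s) : rootE.Ok M s := by
  have := hM.le
  simp +decide [rootE, ok_maxOver, Ex.eval, Ex.Ok, hs.hm, this]

theorem eval_weightE (hs : Params n m D s) :
    weightE.eval s = if s.v xJ < n * m then
      D / s.a aDen (s.v xJ) * s.a aNum (s.v xJ) * n else D := by
  simp +decide [weightE, Ex.eval, eval_lt, hs.hn, hs.hm, hs.hD]

theorem ok_weightE (hM : Enough M n m) (hs : Params n m D s)
    (hnum : (s.a aNum (s.v xJ)).size ≤ M) : weightE.Ok M s := by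
  have := hM.le
  simp +decide [weightE, Ex.eval, Ex.Ok, ok_lt, hs.hn, hs.hm, this, size_le_of_le, hnum]

theorem eval_startE (hs : Params n m D s) :
    startE.eval s = if s.v xJ / (n + 1) % 2 ^ n ≠ 0 then 0 else
      s.a aW (s.v xJ % (n + 1) * m + s.v xJ / (n + 1) / 2 ^ n) + 1 := by
  simp +decide [startE, Ex.eval, eval_mod, hs.hm, hs.hP, hs.hQ]

theorem ok_startE (hM : Enough M n m) (hs : Params n m D s) : startE.Ok M s := by
  have := hM.le
  simp +decide [startE, Ex.eval, Ex.Ok, ok_mod, hs.hm, hs.hP, hs.hQ, this, size_le_of_le]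

/-! ### Elimination of a leaf -/

theorem Params.seta (hs : Params n m D s) (k : Fin 14) (g : ℕ → ℕ) : Params n m D (s.seta k g) :=
  ⟨hs.hn, hs.hm, hs.hP, hs.hQ, hs.hD⟩

theorem Params.setv (hs : Params n m D s) {x : ℕ} (hx : 5 < x) (y : ℕ) :
    Params n m D (s.setv x y) := by
  have h : ∀ z ≤ 5, (s.setv x y).v z = s.v z := by
    intro z hz
    rw [Env.setv_v, Function.update_of_ne (by omega)]
  constructor
  · rw [h _ (by norm_num), hs.hn]
  · rw [h _ (by norm_num), hs.hm]
  · rw [h _ (by norm_num), hs.hP]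
  · rw [h _ (by norm_num), hs.hQ]
  · rw [h _ (by norm_num), hs.hD]

theorem table_index {S i : ℕ} (hi : i < n + 1) :
    (S * (n + 1) + i) / (n + 1) = S ∧ (S * (n + 1) + i) % (n + 1) = i := by
  constructor
  · rw [Nat.mul_comm, Nat.mul_add_div (by omega), Nat.div_eq_of_lt hi, Nat.add_zero]
  · rw [Nat.mul_comm, Nat.mul_add_mod, Nat.mod_eq_of_lt hi]

theorem table_index_lt {S i : ℕ} (hS : S < 2 ^ n) (hi : i < n + 1) :
    S * (n + 1) + i < 2 ^ n * (n + 1) := by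
  calc S * (n + 1) + i < S * (n + 1) + (n + 1) := by omega
    _ = (S + 1) * (n + 1) := by ring
    _ ≤ 2 ^ n * (n + 1) := Nat.mul_le_mul_right _ hS

/-- Replacing the block of `p` in the array of tables. -/
theorem table_replace {g u : ℕ → ℕ} {p v S i : ℕ} (hS : S < 2 ^ n) (hi : i < n + 1) :
    table n (fun x => if p * 2 ^ n * (n + 1) ≤ x ∧ x < p * 2 ^ n * (n + 1) + 2 ^ n * (n + 1) then
      u (x - p * 2 ^ n * (n + 1)) else g x) v S i =
      if v = p then u (S * (n + 1) + i) else table n g v S i := by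
  have hlt := table_index_lt hS hi
  have hidx : (v * 2 ^ n + S) * (n + 1) + i = v * (2 ^ n * (n + 1)) + (S * (n + 1) + i) := by
    ring
  simp only [table, hidx, mul_assoc]
  by_cases hv : v = p
  · subst hv
    rw [if_pos (by omega), if_pos rfl, Nat.add_sub_cancel_left]
  · rw [if_neg hv, if_neg]
    rcases Nat.lt_or_gt_of_ne hv with h | h
    · have := Nat.mul_le_mul_right (2 ^ n * (n + 1)) (Nat.succ_le_of_lt h)
      rw [Nat.succ_mul] at this
      omega
    · have := Nat.mul_le_mul_right (2 ^ n * (n + 1)) (Nat.succ_le_of_lt h)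
      rw [Nat.succ_mul] at this
      omega

variable {G : SimpleGraph (Fin m)} {W : ℕ → Fin m → ℕ}

theorem _root_.ConnectedDivision.IsTable.congr {B : Finset (Fin m)} {v : Fin m} {t t' : ℕ → ℕ → ℕ}
    (h : IsTable G W D n B v t) (ht : ∀ S < 2 ^ n, ∀ i < n + 1, t' S i = t S i) :
    IsTable G W D n B v t' := by
  intro S hS i hi k
  rw [ht S hS i hi]
  exact h S hS i hi k

theorem _root_.ConnectedDivision.mergeTable_congr {t t' : ℕ → ℕ → ℕ} {e e' : ℕ → ℕ}
    (h : ∀ S < 2 ^ n, e S = e' S) : mergeTable n t t' e = mergeTable n t t' e' := by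
  funext S i
  refine Finset.sup_congr rfl fun S₁ _ => Finset.sup_congr rfl fun S₂ hS₂ => ?_
  simp only [h S₂ (Finset.mem_range.1 hS₂)]

/-- The state of the elimination after `r` rounds. -/
structure Progress {m : ℕ} (G : SimpleGraph (Fin m)) (W : ℕ → Fin m → ℕ) (D n r : ℕ)
    (s : Env) : Prop extends Params n m D s where
  adj : ∀ v w : Fin m, G.Adj v w → s.a aAdj (v * m + w) = 1
  not_adj : ∀ v w : Fin m, ¬ G.Adj v w → s.a aAdj (v * m + w) = 0
  blobs : ∃ (A : Finset (Fin m)) (B : Fin m → Finset (Fin m)), A.card + r = m ∧ Conn G A ∧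
    IsBlobs G A B ∧ (∀ v : Fin m, s.a aAlive v = if v ∈ A then 1 else 0) ∧
    ∀ v ∈ A, IsTable G W D n (B v) v (table n (s.a aT) v)

theorem sum_alive_eq_one_iff {r : ℕ} (h : Progress G W D n r s) {A : Finset (Fin m)}
    (hA : ∀ v : Fin m, s.a aAlive v = if v ∈ A then 1 else 0) (v : Fin m) :
    ∑ w ∈ Finset.range m, (if s.a aAlive w ≠ 0 then s.a aAdj (v * m + w) else 0) = 1 ↔
      ∃! w, w ∈ A ∧ G.Adj v w := by
  classical
  rw [Finset.sum_range]
  have : ∀ w : Fin m, (if s.a aAlive w ≠ 0 then s.a aAdj (v * m + w) else 0) =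
      if w ∈ A ∧ G.Adj v w then 1 else 0 := by
    intro w
    by_cases hw : w ∈ A <;> by_cases hvw : G.Adj v w <;>
      simp [hA, hw, hvw, h.adj v w, h.not_adj v w]
  simp only [this]
  rw [Finset.sum_boole, Nat.cast_id, Finset.card_eq_one, Finset.singleton_iff_unique_mem]
  simp

/-- A leaf exists, so the maximum is positive. It is attained at some index `c`, and a nonzero value
there certifies that `c` survives and has exactly one surviving neighbour. -/
theorem exists_eval_leafE (hG : G.IsAcyclic) {r : ℕ} (h : Progress G W D n r s)
    {A : Finset (Fin m)} (hA : ∀ v : Fin m, s.a aAlive v = if v ∈ A then 1 else 0)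
    (hconn : Conn G A) (hcard : 1 < A.card) :
    ∃ c p : Fin m, leafE.eval s = c + 1 ∧ c ∈ A ∧ p ∈ A ∧ G.Adj c p ∧
      ∀ w ∈ A, G.Adj c w → w = p := by
  obtain ⟨v, hv, huniq⟩ := hconn.exists_leaf hG hcard
  rw [eval_leafE h.toParams]
  set f : ℕ → ℕ := fun v => if s.a aAlive v ≠ 0 then
      if ∑ w ∈ Finset.range m, (if s.a aAlive w ≠ 0 then s.a aAdj (v * m + w) else 0) = 1 then
        v + 1 else 0 else 0 with hf
  have hfv : f v = v + 1 := by
    have := (sum_alive_eq_one_iff h hA v).2 huniq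
    simp only [hf, this]
    simp [hA, hv]
  have hle : f v ≤ (Finset.range m).sup f := Finset.le_sup (by simp)
  obtain ⟨c, hc, hcs⟩ := Finset.exists_mem_eq_sup (Finset.range m) ⟨v, by simp⟩ f
  rw [Finset.mem_range] at hc
  rw [hcs]
  have hpos : f c ≠ 0 := by omega
  simp only [hf] at hpos ⊢
  split_ifs at hpos ⊢ with h₁ h₂
  · have hcA : (⟨c, hc⟩ : Fin m) ∈ A := by
      have := hA ⟨c, hc⟩
      by_contra hcA
      rw [if_neg hcA] at this
      exact h₁ this
    obtain ⟨p, hp, hu⟩ := (sum_alive_eq_one_iff h hA ⟨c, hc⟩).1 h₂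
    exact ⟨⟨c, hc⟩, p, rfl, hcA, hp.1, hp.2, fun w hw hcw => hu w ⟨hw, hcw⟩⟩
  · exact absurd rfl hpos
  · exact absurd rfl hpos

/-- The sum of the indices of the surviving neighbours has the single term `p`, since `c` is a leaf.
-/
theorem eval_parentE_eq {r : ℕ} (h : Progress G W D n r s) {A : Finset (Fin m)}
    (hA : ∀ v : Fin m, s.a aAlive v = if v ∈ A then 1 else 0) {c p : Fin m} (hp : p ∈ A)
    (hcp : G.Adj c p) (hleaf : ∀ w ∈ A, G.Adj c w → w = p) :
    parentE.eval (s.setv xC c) = p := by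
  rw [eval_parentE (h.toParams.setv (by norm_num) _), Finset.sum_range]
  simp only [Env.setv_a, Env.setv_v, Function.update_self]
  rw [Finset.sum_eq_single p]
  · simp [hA, hp, h.adj c p hcp]
  · intro w _ hwp
    by_cases hw : w ∈ A
    · have : ¬ G.Adj c w := fun hcw => hwp (hleaf w hw hcw)
      simp [h.not_adj c w this]
    · simp [hA, hw]
  · simp

theorem spec_eliminate (hG : G.IsAcyclic) (hn : ∀ v, W n v = D) (hM : Enough M n m) {r : ℕ}
    (hr : r < m - 1) (h : Progress G W D n r s) :
    eliminate.Spec M s (Progress G W D n (r + 1)) := by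
  obtain ⟨A, B, hcard, hconn, hblobs, halive, htab⟩ := h.blobs
  -- From `r < m - 1` and `A.card + r = m`, at least two vertices survive, as the existence of a
  -- leaf requires.
  obtain ⟨c, p, hc, hcA, hpA, hcp, hleaf⟩ :=
    exists_eval_leafE hG h halive hconn (by omega)
  have hpc : p ≠ c := hcp.ne'
  have hparent := eval_parentE_eq h halive hpA hcp hleaf
  have hle := hM.le
  have hp₁ := h.toParams.setv (x := xC) (by norm_num) c
  have hp₂ := hp₁.setv (x := xR) (by norm_num) p
  refine spec_seq (spec_assign ⟨ok_leafE hM h.toParams, trivial⟩ ?_)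
  have hc' : (leafE.sub (lit 1)).eval s = c := by simp [Ex.eval, hc]
  rw [hc']
  refine spec_seq (spec_assign (ok_parentE hM hp₁) ?_)
  rw [hparent]
  set s₂ := (s.setv xC c).setv xR p with hs₂
  have hs₂C : s₂.v xC = c := by simp [hs₂]
  have hs₂R : s₂.v xR = p := by simp [hs₂]
  have hs₂a : s₂.a = s.a := rfl
  refine spec_seq (spec_tabulate (o := 0) (g := served D n (table n (s.a aT) c)) trivial
    (by simpa [Ex.eval, hp₂.hP] using hle.2.2.1) (fun _ _ _ => ⟨trivial, rfl⟩) ?_ ?_)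
  · intro j _ g
    have hp₃ := (hp₂.seta aE g).setv (x := xJ) (by norm_num) j
    refine ⟨ok_servedE_var hM hp₃, ?_⟩
    rw [eval_servedE_var hp₃]
    simp [hs₂C, hs₂a]
  set e : ℕ → ℕ := fun x => if 0 ≤ x ∧ x < 0 + (var xP).eval s₂ then
    served D n (table n (s.a aT) c) (x - 0) else s₂.a aE x with he
  have heq : ∀ S < 2 ^ n, e S = served D n (table n (s.a aT) c) S := by
    intro S hS
    simp [he, Ex.eval, hp₂.hP, hS]
  have hp₃ := hp₂.seta aE e
  have hPQ : (mul (var xP) (var xQ)).Ok M s₂ ∧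
      (mul (var xP) (var xQ)).eval s₂ = 2 ^ n * (n + 1) := by
    simp [Ex.Ok, Ex.eval, hp₂.hP, hp₂.hQ, size_le_of_le hle.2.1]
  -- Entries of the merged table depend on other entries of the old table of `p`, so it is built in
  -- the scratch array `aU` and copied over the block of `p` only when complete.
  refine spec_seq (spec_tabulate (o := 0) (g := fun j => mergeTable n (table n (s.a aT) p)
    (table n (s.a aT) c) e (j / (n + 1)) (j % (n + 1))) hPQ.1 (hPQ.2.trans_le hM.pow)
    (fun _ _ _ => ⟨trivial, rfl⟩) ?_ ?_)
  · intro j _ g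
    have hp₄ := (hp₃.seta aU g).setv (x := xJ) (by norm_num) j
    refine ⟨ok_mergeE hM hp₄, ?_⟩
    rw [eval_mergeE hp₄]
    simp [hs₂C, hs₂R, hs₂a]
  set u : ℕ → ℕ := fun x => if 0 ≤ x ∧ x < 0 + (mul (var xP) (var xQ)).eval (s₂.seta aE e) then
    mergeTable n (table n (s.a aT) p) (table n (s.a aT) c) e ((x - 0) / (n + 1))
      ((x - 0) % (n + 1)) else (s₂.seta aE e).a aU x with hu
  have hueq : ∀ S < 2 ^ n, ∀ i < n + 1, u (S * (n + 1) + i) =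
      mergeTable n (table n (s.a aT) p) (table n (s.a aT) c)
        (served D n (table n (s.a aT) c)) S i := by
    intro S hS i hi
    have h₁ : (mul (var xP) (var xQ)).eval (s₂.seta aE e) = 2 ^ n * (n + 1) := hPQ.2
    simp only [hu, h₁, Nat.sub_zero, Nat.zero_add, Nat.zero_le, true_and, table_index_lt hS hi,
      if_true, table_index hi, mergeTable_congr heq]
  have hoff : ∀ g j, (mul (mul (var xR) (var xP)) (var xQ)).Ok M
      ((((s₂.seta aE e).seta aU u).seta aT g).setv xJ j) ∧
      (mul (mul (var xR) (var xP)) (var xQ)).eval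
        ((((s₂.seta aE e).seta aU u).seta aT g).setv xJ j) = p * 2 ^ n * (n + 1) := by
    intro g j
    simp [Ex.Ok, Ex.eval, hp₂.hP, hp₂.hQ, hs₂R, size_le_of_le hle.2.1, size_le_of_le hle.2.2.1]
  refine spec_seq (spec_tabulate (o := p * 2 ^ n * (n + 1)) (g := u) hPQ.1
    (hPQ.2.trans_le hM.pow) (fun j _ g => hoff g j) ?_ ?_)
  · intro j _ g
    exact ⟨trivial, by simp [Ex.eval]⟩
  refine spec_write trivial trivial ?_
  refine ⟨(((hp₃.seta aU u).seta aT _).seta aAlive _), ?_, ?_, A.erase c,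
    Function.update B p (B p ∪ B c), ?_, hconn.erase_leaf hpA hpc hleaf,
    hblobs.merge hpA hcA hpc hleaf, ?_, ?_⟩
  · intro v w hvw
    simpa [hs₂a] using h.adj v w hvw
  · intro v w hvw
    simpa [hs₂a] using h.not_adj v w hvw
  · rw [Finset.card_erase_of_mem hcA]
    have := Finset.card_pos.2 ⟨c, hcA⟩
    omega
  · intro v
    by_cases hvc : v = c
    · simp [hvc, Ex.eval, hs₂C]
    · have : (v : ℕ) ≠ c := fun h => hvc (Fin.ext h)
      simp [hvc, Ex.eval, hs₂C, this, hs₂a, halive]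
  · intro v hv
    rw [Finset.mem_erase] at hv
    have ht : ∀ S < 2 ^ n, ∀ i < n + 1, table n (fun x => if p * 2 ^ n * (n + 1) ≤ x ∧
        x < p * 2 ^ n * (n + 1) + 2 ^ n * (n + 1) then
        u (x - p * 2 ^ n * (n + 1)) else s.a aT x) v S i =
        if (v : ℕ) = p then u (S * (n + 1) + i) else table n (s.a aT) v S i :=
      fun S hS i hi => table_replace hS hi
    have hPQ' : (mul (var xP) (var xQ)).eval ((s₂.seta aE e).seta aU u) = 2 ^ n * (n + 1) := hPQ.2
    simp only [hPQ', Env.seta_a, Function.update_self, ne_eq, Fin.reduceEq, not_false_eq_true,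
      Function.update_of_ne, hs₂a]
    by_cases hvp : v = p
    · subst hvp
      rw [Function.update_self]
      refine ((htab v hpA).merge (htab c hcA) hn (hblobs.disjoint v hpA c hcA hpc)
        (hblobs.mem v hpA) (hblobs.mem c hcA) hcp.symm
        fun x hx y hy hxy => hblobs.edge hpA hcA hpc hx hy hxy).congr fun S hS i hi => ?_
      rw [ht S hS i hi, if_pos rfl, hueq S hS i hi]
    · rw [Function.update_of_ne hvp]
      refine (htab v hv.2).congr fun S hS i hi => ?_
      rw [ht S hS i hi, if_neg fun h => hvp (Fin.ext h)]

/-! ### Reading the input -/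

theorem headD_drop (l : List ℕ) (j : ℕ) : (l.drop j).headD 0 = l.getD j 0 := by
  induction l generalizing j with
  | nil => simp
  | cons a l ih =>
    cases j with
    | zero => rfl
    | succ j => simp

theorem spec_readGraph (hm : s.v xM = m) (hmM : m ≤ M) (hM : m * m ≤ M)
    (hinp : ∀ j, (s.inp.getD j 0).size ≤ M) (hnum : ∀ j, (s.a aNum j).size ≤ M) :
    readGraph.Spec M s fun t => t.inp = s.inp.drop (m * m) ∧ (∀ y, y ≠ xIn → t.v y = s.v y) ∧
      (∀ j < m * m, t.a aAdj j = s.inp.getD j 0) ∧ ∀ j, (t.a aNum j).size ≤ M := by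
  have hN : (mul (var xM) (var xM)).eval s = m * m := by simp [Ex.eval, hm]
  refine spec_for (fun i t => t.inp = s.inp.drop i ∧
    (∀ y, y ≠ xIn → y ≠ xJ → t.v y = s.v y) ∧ (∀ j < i, t.a aAdj j = s.inp.getD j 0) ∧
    ∀ j, (t.a aNum j).size ≤ M) ?_ ?_ ?_ ?_ ?_
  · simp [Ex.Ok, Ex.eval, hm, size_le_of_le hmM]
  · rwa [hN]
  · simpa using hnum
  · rintro i hi t ⟨h₁, h₂, h₃, h₄⟩
    have hh : (t.setv xJ i).inp.headD 0 = s.inp.getD i 0 := by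
      rw [Env.setv_inp, h₁, headD_drop]
    refine spec_seq (spec_read (by rw [hh]; exact hinp i) ?_)
    refine spec_write trivial trivial ⟨?_, ?_, ?_, ?_⟩
    · simp [h₁, List.tail_drop]
    · intro y hy hy'
      simp [hy, hy', h₂]
    · intro j hj
      by_cases hji : j = i
      · subst hji
        rw [← hh]
        simp [Ex.eval]
      · simp [Ex.eval, hji, h₃ j (by omega)]
    · simpa using h₄
  · rintro t ⟨h₁, h₂, h₃, h₄⟩
    rw [hN] at h₁ h₃
    refine ⟨h₁, fun y hy => ?_, h₃, h₄⟩
    by_cases hyj : y = xJ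
    · simp [hyj]
    · simp [hyj, h₂ y hy hyj]

/-- The size bound on `aNum` is kept for all indices, also those never filled: `Ex.Ok` of a
conditional concerns both branches, so `weightE` needs it even in the row of the dummy player. -/
theorem spec_readUtils (hn : s.v xN = n) (hm : s.v xM = m) (hD : s.v xD = 1) (hmM : m ≤ M)
    (hM : n * m ≤ M) (hinp : ∀ j, (s.inp.getD j 0).size ≤ M)
    (hnum : ∀ j, (s.a aNum j).size ≤ M) :
    readUtils.Spec M s fun t => (∀ y, y ≠ xIn → y ≠ xD → t.v y = s.v y) ∧
      t.v xD = ∏ j ∈ Finset.range (n * m), s.inp.getD (2 * j + 1) 0 ∧ t.a aAdj = s.a aAdj ∧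
      (∀ j < n * m, t.a aNum j = s.inp.getD (2 * j) 0 ∧
        t.a aDen j = s.inp.getD (2 * j + 1) 0) ∧ ∀ j, (t.a aNum j).size ≤ M := by
  have hN : (mul (var xN) (var xM)).eval s = n * m := by simp [Ex.eval, hn, hm]
  refine spec_for (fun i t => t.inp = s.inp.drop (2 * i) ∧
    (∀ y, y ≠ xIn → y ≠ xD → y ≠ xJ → t.v y = s.v y) ∧
    t.v xD = ∏ j ∈ Finset.range i, s.inp.getD (2 * j + 1) 0 ∧ t.a aAdj = s.a aAdj ∧
      (∀ j < i, t.a aNum j = s.inp.getD (2 * j) 0 ∧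
        t.a aDen j = s.inp.getD (2 * j + 1) 0) ∧ ∀ j, (t.a aNum j).size ≤ M) ?_ ?_ ?_ ?_ ?_
  · simp [Ex.Ok, Ex.eval, hm, size_le_of_le hmM]
  · rwa [hN]
  · simpa [hD] using hnum
  · rintro i hi t ⟨h₁, h₂, h₃, h₄, h₅, h₆⟩
    have hh : (t.setv xJ i).inp.headD 0 = s.inp.getD (2 * i) 0 := by
      rw [Env.setv_inp, h₁, headD_drop]
    have hh' : (t.setv xJ i).inp.tail.headD 0 = s.inp.getD (2 * i + 1) 0 := by
      rw [Env.setv_inp, h₁, List.tail_drop, headD_drop]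
    refine spec_seq (spec_read (by rw [hh]; exact hinp _) ?_)
    refine spec_seq (spec_write trivial trivial ?_)
    refine spec_seq (spec_read ?_ ?_)
    · exact hh'.symm ▸ hinp _
    refine spec_seq (spec_write trivial trivial ?_)
    -- The growing product is the first factor; the second is the denominator just read, whose size
    -- is at most `M`.
    refine spec_assign ⟨trivial, trivial, ?_⟩ ⟨?_, ?_, ?_, ?_, ?_, ?_⟩
    · simpa [Ex.eval, ← hh', h₁] using hinp (2 * i + 1)
    · simp [h₁, List.tail_drop, mul_add]
    · intro y hy hy' hy''
      simp [hy, hy', hy'', h₂]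
    · rw [Finset.prod_range_succ, ← h₃, ← hh']
      simp [Ex.eval]
    · simp [h₄]
    · intro j hj
      by_cases hji : j = i
      · subst hji
        rw [← hh, ← hh']
        simp [Ex.eval]
      · simp [Ex.eval, hji, h₅ j (by omega)]
    · intro j
      by_cases hji : j = i
      · have := hinp (2 * i)
        rw [← hh] at this
        simpa [Ex.eval, hji] using this
      · simpa [Ex.eval, hji] using h₆ j
  · rintro t ⟨-, h₂, h₃, h₄, h₅, h₆⟩
    rw [hN] at h₃ h₅
    refine ⟨fun y hy hy' => ?_, by simpa using h₃, h₄, h₅, h₆⟩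
    by_cases hyj : y = xJ
    · simp [hyj]
    · simp [hyj, h₂ y hy hy' hyj]

/-! ### Correctness of the program -/

theorem Progress.setv {r : ℕ} (h : Progress G W D n r s) {x : ℕ} (hx : 5 < x) (y : ℕ) :
    Progress G W D n r (s.setv x y) :=
  ⟨h.toParams.setv hx y, h.adj, h.not_adj, h.blobs⟩

theorem served_eq_ite {V : Type*} [DecidableEq V] {G : SimpleGraph V} {W : ℕ → V → ℕ}
    {B : Finset V} {v : V} {t : ℕ → ℕ → ℕ}
    (ht : IsTable G W D n B v t) (hv : v ∈ B) (hn : ∀ v, W n v = D) (S : ℕ) :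
    (Serves G W D B (players n S) → served D n t S = 1) ∧
      (¬ Serves G W D B (players n S) → served D n t S = 0) := by
  have h₀ := lt_served_iff ht hv hn S 0
  have h₁ := lt_served_iff ht hv hn S 1
  constructor
  · intro h
    have := h₀.2 ⟨rfl, h⟩
    have : ¬ 1 < served D n t S := fun h => one_ne_zero (h₁.1 h).1
    omega
  · intro h
    have : ¬ 0 < served D n t S := fun h' => h (h₀.1 h').2
    omega

/-- The part of the program that follows the elimination. -/
theorem spec_answer (hn : ∀ v, W n v = D) (hM : Enough M n m) (hm : 0 < m)
    (h : Progress G W D n (m - 1) s) :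
    (seq (assign xC (sub rootE (lit 1))) <| seq (assign xJ (sub (var xP) (lit 1))) <|
      assign 0 (servedE (var xC) (var xJ))).Spec M s fun t =>
      (Serves G W D Finset.univ (Finset.range n) → t.v 0 = 1) ∧
        (¬ Serves G W D Finset.univ (Finset.range n) → t.v 0 = 0) := by
  obtain ⟨A, B, hcard, -, hblobs, halive, htab⟩ := h.blobs
  -- One vertex survives the `m - 1` rounds; since the surviving blobs cover the graph, its blob is
  -- everything.
  obtain ⟨r, rfl⟩ := Finset.card_eq_one.1 (show A.card = 1 by omega)
  have hroot : rootE.eval s = r + 1 := by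
    rw [eval_rootE h.toParams]
    have hf : ∀ v : Fin m, (if s.a aAlive v ≠ 0 then (v : ℕ) + 1 else 0) =
        if v = r then (r : ℕ) + 1 else 0 := by
      intro v
      by_cases hv : v = r <;> simp [halive, hv]
    refine le_antisymm (Finset.sup_le fun v hv => ?_) ?_
    · have := hf ⟨v, Finset.mem_range.1 hv⟩
      simp only at this
      rw [this]
      split_ifs <;> omega
    · have := Finset.le_sup (f := fun v => if s.a aAlive v ≠ 0 then v + 1 else 0)
        (Finset.mem_range.2 r.2)
      simp only [hf r, if_true] at this
      exact this
  have hB : B r = Finset.univ := by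
    refine Finset.eq_univ_iff_forall.2 fun x => ?_
    obtain ⟨v, hv, hx⟩ := hblobs.cover x
    rwa [Finset.mem_singleton.1 hv] at hx
  have hp₁ := h.toParams.setv (x := xC) (by norm_num) ((rootE.sub (lit 1)).eval s)
  have hp₂ := hp₁.setv (x := xJ) (by norm_num)
    (((var xP).sub (lit 1)).eval (s.setv xC ((rootE.sub (lit 1)).eval s)))
  refine spec_seq (spec_assign ⟨ok_rootE hM h.toParams, trivial⟩ ?_)
  refine spec_seq (spec_assign ⟨trivial, trivial⟩ ?_)
  refine spec_assign (ok_servedE_var hM hp₂) ?_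
  rw [eval_servedE_var hp₂]
  have := served_eq_ite (htab r (by simp)) (hblobs.mem r (by simp)) hn (2 ^ n - 1)
  rw [hB, players_pred_two_pow] at this
  simpa [Ex.eval, hroot, h.hP] using this

variable {s : Env} {M n m D : ℕ} {G : SimpleGraph (Fin m)} {W : ℕ → Fin m → ℕ}

theorem grid_lt {i v : ℕ} {N : ℕ} (hi : i < N) (hv : v < m) : i * m + v < N * m :=
  calc i * m + v < i * m + m := by omega
    _ = (i + 1) * m := by ring
    _ ≤ N * m := Nat.mul_le_mul_right _ hi

/-- The part of the program that follows the reading of the input. -/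
theorem spec_main (hG : G.IsTree) (hn : ∀ v, W n v = D) (hD : 0 < D) (hM : Enough M n m)
    (hsn : s.v xN = n) (hsm : s.v xM = m) (hsD : s.v xD = D)
    (hadj : ∀ v w : Fin m, G.Adj v w → s.a aAdj (v * m + w) = 1)
    (hnadj : ∀ v w : Fin m, ¬ G.Adj v w → s.a aAdj (v * m + w) = 0)
    (hnum : ∀ j, (s.a aNum j).size ≤ M)
    (hW : ∀ i < n, ∀ v : Fin m,
      W i v = D / s.a aDen (i * m + v) * s.a aNum (i * m + v) * n) :
    (seq (assign xP (pow 11 12 (var xN))) <| seq (assign xQ (add (var xN) (lit 1))) <|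
      seq (tabulate aW (lit 0) xJ (mul (var xQ) (var xM)) weightE) <|
      seq (tabulate aAlive (lit 0) xJ (var xM) (lit 1)) <|
      seq (tabulate aT (lit 0) xJ (mul (mul (var xM) (var xP)) (var xQ)) startE) <|
      seq (.for xK (sub (var xM) (lit 1)) eliminate) <|
      seq (assign xC (sub rootE (lit 1))) <|
      seq (assign xJ (sub (var xP) (lit 1))) <|
      assign 0 (servedE (var xC) (var xJ))).Spec M s fun t =>
      (Serves G W D Finset.univ (Finset.range n) → t.v 0 = 1) ∧
        (¬ Serves G W D Finset.univ (Finset.range n) → t.v 0 = 0) := by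
  have hle := hM.le
  obtain ⟨v₀⟩ := hG.connected.nonempty
  have hm : 0 < m := v₀.pos
  refine spec_seq (spec_assign (ok_pow.2 ⟨trivial, by simpa [Ex.eval, hsn] using hle.1⟩) ?_)
  refine spec_seq (spec_assign ⟨trivial, trivial⟩ ?_)
  set s₁ := (s.setv xP ((pow 11 12 (var xN)).eval s)).setv xQ
    (((var xN).add (lit 1)).eval (s.setv xP ((pow 11 12 (var xN)).eval s))) with hs₁
  have hp : Params n m D s₁ := by
    constructor <;> simp [hs₁, eval_pow, Ex.eval, hsn, hsm, hsD]
  have ha : s₁.a = s.a := rfl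
  have hQM : (mul (var xQ) (var xM)).eval s₁ = (n + 1) * m := by simp [Ex.eval, hp.hQ, hp.hm]
  refine spec_seq (spec_tabulate (o := 0) (g := fun j => if j < n * m then
    D / s.a aDen j * s.a aNum j * n else D) ?_ (hQM.trans_le hle.2.2.2.2.1)
    (fun _ _ _ => ⟨trivial, rfl⟩) ?_ ?_)
  · simp [Ex.Ok, Ex.eval, hp.hm, size_le_of_le hle.2.2.2.1]
  · intro j hj g
    have hp' := (hp.seta aW g).setv (x := xJ) (by norm_num) j
    refine ⟨?_, ?_⟩
    · exact ok_weightE hM hp' (by simpa [ha] using hnum j)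
    · rw [eval_weightE hp']
      simp [ha]
  set w : ℕ → ℕ := fun x => if 0 ≤ x ∧ x < 0 + (mul (var xQ) (var xM)).eval s₁ then
    (if x - 0 < n * m then D / s.a aDen (x - 0) * s.a aNum (x - 0) * n else D)
    else s₁.a aW x with hw
  -- The row `i = n` is included; there the stored weight is the constant `D` of the dummy player.
  have hwW : ∀ i < n + 1, ∀ v : Fin m, w (i * m + v) = W i v := by
    intro i hi v
    have h₁ := grid_lt hi v.2
    simp only [hw, hQM, Nat.zero_add, Nat.zero_le, h₁, and_self, if_true, Nat.sub_zero]
    by_cases hin : i < n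
    · rw [if_pos (grid_lt hin v.2), hW i hin v]
    · obtain rfl : i = n := by omega
      rw [if_neg (by omega), hn v]
  have hp₂ := hp.seta aW w
  refine spec_seq (spec_tabulate (o := 0) (g := fun _ => 1) trivial
    (by simpa [Ex.eval, hp.hm] using hle.2.2.2.1) (fun _ _ _ => ⟨trivial, rfl⟩)
    (fun _ _ _ => ⟨trivial, rfl⟩) ?_)
  set al : ℕ → ℕ := fun x => if 0 ≤ x ∧ x < 0 + (var xM).eval (s₁.seta aW w) then 1
    else (s₁.seta aW w).a aAlive x with hal
  have hal' : ∀ v : Fin m, al v = 1 := by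
    intro v
    simp [hal, Ex.eval, hp.hm]
  have hp₃ := hp₂.seta aAlive al
  have hN : (mul (mul (var xM) (var xP)) (var xQ)).eval ((s₁.seta aW w).seta aAlive al) =
      m * 2 ^ n * (n + 1) := by
    simp [Ex.eval, hp.hm, hp.hP, hp.hQ]
  refine spec_seq (spec_tabulate (o := 0) (g := fun j => if j / (n + 1) % 2 ^ n ≠ 0 then 0 else
      w (j % (n + 1) * m + j / (n + 1) / 2 ^ n) + 1) ?_ (hN.trans_le hM.entries)
    (fun _ _ _ => ⟨trivial, rfl⟩) ?_ ?_)
  · simp [Ex.Ok, Ex.eval, hp.hP, hp.hQ, size_le_of_le hle.2.1, size_le_of_le hle.2.2.1]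
  · intro j _ g
    have hp' := (hp₃.seta aT g).setv (x := xJ) (by norm_num) j
    refine ⟨ok_startE hM hp', ?_⟩
    rw [eval_startE hp']
    simp
  set T : ℕ → ℕ := fun x => if 0 ≤ x ∧
    x < 0 + (mul (mul (var xM) (var xP)) (var xQ)).eval ((s₁.seta aW w).seta aAlive al) then
    (if (x - 0) / (n + 1) % 2 ^ n ≠ 0 then 0 else
      w ((x - 0) % (n + 1) * m + (x - 0) / (n + 1) / 2 ^ n) + 1)
    else ((s₁.seta aW w).seta aAlive al).a aT x with hT
  have hTW : ∀ v : Fin m, ∀ S < 2 ^ n, ∀ i < n + 1,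
      table n T v S i = if S ≠ 0 then 0 else W i v + 1 := by
    intro v S hS i hi
    have h₁ : (v * 2 ^ n + S) * (n + 1) + i < m * 2 ^ n * (n + 1) :=
      grid_lt (grid_lt v.2 hS) hi
    have h₂ : ((v : ℕ) * 2 ^ n + S) % 2 ^ n = S := by
      rw [Nat.mul_comm, Nat.mul_add_mod, Nat.mod_eq_of_lt hS]
    have h₃ : ((v : ℕ) * 2 ^ n + S) / 2 ^ n = v := by
      rw [Nat.mul_comm, Nat.mul_add_div (by positivity), Nat.div_eq_of_lt hS, Nat.add_zero]
    simp only [table, hT, hN, Nat.zero_add, Nat.zero_le, h₁, and_self, if_true, Nat.sub_zero,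
      table_index hi, h₂, h₃, hwW i hi v]
  -- Initially all vertices survive and each is its own blob.
  have hprog : Progress G W D n 0 (((s₁.seta aW w).seta aAlive al).seta aT T) := by
    refine ⟨hp₃.seta aT T, ?_, ?_, Finset.univ, fun v => {v}, by simp, ?_, isBlobs_singleton,
      ?_, ?_⟩
    · intro v w' hvw
      simpa [ha] using hadj v w' hvw
    · intro v w' hvw
      simpa [ha] using hnadj v w' hvw
    · rintro ⟨x, -⟩ ⟨y, -⟩
      exact reachable_map (G' := G.induce ((Finset.univ : Finset (Fin m)) : Set (Fin m)))
        (fun z => ⟨z, by simp⟩) (fun _ _ h => SimpleGraph.Adj.reachable (by simpa using h))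
        (hG.connected.preconnected x y)
    · intro v
      simp [hal' v]
    · intro v _
      refine (isTable_singleton hD v).congr fun S hS i hi => ?_
      simpa using hTW v S hS i hi
  have hm1 : (sub (var xM) (lit 1)).eval (((s₁.seta aW w).seta aAlive al).seta aT T) = m - 1 := by
    simp [Ex.eval, hp.hm]
  refine spec_seq (spec_for (Progress G W D n) ⟨trivial, trivial⟩ ?_ hprog ?_ ?_)
  · rw [hm1]
    omega
  · intro r hr t ht
    rw [hm1] at hr
    exact spec_eliminate hG.isAcyclic hn hM hr (ht.setv (by norm_num) r)
  · intro t ht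
    rw [hm1] at ht
    exact spec_answer hn hM hm (ht.setv (by norm_num) _)

/-! ### The input word -/

/-- All blocks have the same length `c`, so entry `j` of block `i` stands at position `i * c + j`.
The utilities need this twice, for players and for items. -/
theorem getD_flatMap {α : Type*} {c : ℕ} (g : α → List ℕ) (hg : ∀ a, (g a).length = c)
    (l : List α) {i j : ℕ} (hi : i < l.length) (hj : j < c) :
    (l.flatMap g).getD (i * c + j) 0 = (g l[i]).getD j 0 := by
  induction l generalizing i with
  | nil => simp at hi
  | cons a l ih =>
    rw [List.flatMap_cons]
    cases i with
    | zero => rw [Nat.zero_mul, Nat.zero_add, List.getD_append _ _ _ _ (by rw [hg]; exact hj)]; rfl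
    | succ i =>
      rw [List.getD_append_right _ _ _ _ (by rw [hg, Nat.succ_mul]; omega), hg]
      have : (i + 1) * c + j - c = i * c + j := by
        rw [Nat.succ_mul]
        omega
      rw [this, ih (by simpa using hi)]
      rfl

theorem getD_flatMap_finRange {k c : ℕ} (g : Fin k → List ℕ) (hg : ∀ a, (g a).length = c)
    (i : Fin k) {j : ℕ} (hj : j < c) :
    ((List.finRange k).flatMap g).getD (i * c + j) 0 = (g i).getD j 0 := by
  rw [getD_flatMap g hg _ (by simp) hj]
  simp

open Classical in
/-- The adjacency matrix in the input word. -/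
noncomputable def matrixWord (I : CFD) : List ℕ :=
  (List.finRange I.m).flatMap fun v =>
    (List.finRange I.m).map fun w => if I.graph.Adj v w then 1 else 0

/-- The utilities in the input word. -/
def utilWord (I : CFD) : List ℕ :=
  (List.finRange I.n).flatMap fun i =>
    (List.finRange I.m).flatMap fun v => [(I.util i v).num.toNat, (I.util i v).den]

theorem encode_eq (I : CFD) : I.encode = I.n :: I.m :: (matrixWord I ++ utilWord I) := by
  simp [CFD.encode, matrixWord, utilWord]

variable (I : CFD)

theorem length_matrixWord : (matrixWord I).length = I.m * I.m := by
  simp [matrixWord, List.length_flatMap]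

open Classical in
theorem getD_matrixWord (v w : Fin I.m) :
    (matrixWord I).getD (v * I.m + w) 0 = if I.graph.Adj v w then 1 else 0 := by
  rw [matrixWord, getD_flatMap_finRange _ (by simp) v w.2]
  simp [List.getD_eq_getElem?_getD]

theorem getD_utilWord (i : Fin I.n) (v : Fin I.m) :
    (utilWord I).getD (2 * (i * I.m + v)) 0 = (I.util i v).num.toNat ∧
      (utilWord I).getD (2 * (i * I.m + v) + 1) 0 = (I.util i v).den := by
  have hlen : ∀ a : Fin I.n, ((List.finRange I.m).flatMap fun v =>
      [(I.util a v).num.toNat, (I.util a v).den]).length = I.m * 2 := by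
    intro a
    simp [List.length_flatMap]
  have h₀ : 2 * (i * I.m + v : ℕ) = i * (I.m * 2) + (v * 2 + 0) := by ring
  have h₁ : 2 * (i * I.m + v : ℕ) + 1 = i * (I.m * 2) + (v * 2 + 1) := by ring
  constructor
  · rw [h₀, utilWord, getD_flatMap_finRange _ hlen i (by omega),
      getD_flatMap_finRange (c := 2) _ (fun _ => rfl) v (by omega)]
    rfl
  · rw [h₁, utilWord, getD_flatMap_finRange _ hlen i (by omega),
      getD_flatMap_finRange (c := 2) _ (fun _ => rfl) v (by omega)]
    rfl

theorem size_getD_le_inputSize (l : List ℕ) (j : ℕ) : (l.getD j 0).size ≤ inputSize l := by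
  by_cases hj : j < l.length
  · rw [List.getD_eq_getElem _ _ hj]
    have : lc l[j] ≤ inputSize l :=
      List.single_le_sum (by simp) _ (List.mem_map.2 ⟨_, List.getElem_mem hj, rfl⟩)
    simp only [lc] at this
    omega
  · rw [List.getD_eq_default _ _ (by omega)]
    simp

theorem length_le_inputSize (l : List ℕ) : l.length ≤ inputSize l := by
  induction l with
  | nil => simp
  | cons a l ih =>
    simp only [inputSize, List.map_cons, List.sum_cons, List.length_cons, lc] at *
    omega

/-! ### Integral weights -/

/-- The product of all denominators. -/
def commonDen : ℕ :=
  ∏ j ∈ Finset.range (I.n * I.m), (utilWord I).getD (2 * j + 1) 0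

/-- The utilities multiplied by the number of players and by the common denominator; the player
`n` likes all items. -/
def weight (i : ℕ) (v : Fin I.m) : ℕ :=
  if h : i < I.n then
    commonDen I / (I.util ⟨i, h⟩ v).den * (I.util ⟨i, h⟩ v).num.toNat * I.n
  else commonDen I

theorem commonDen_pos : 0 < commonDen I := by
  refine Finset.prod_pos fun j hj => ?_
  rw [Finset.mem_range] at hj
  have hm : 0 < I.m := Nat.pos_of_ne_zero fun h => by simp [h] at hj
  have h := (getD_utilWord I ⟨j / I.m, (Nat.div_lt_iff_lt_mul hm).2 hj⟩
    ⟨j % I.m, Nat.mod_lt _ hm⟩).2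
  simp only [Nat.div_add_mod'] at h
  rw [h]
  exact Rat.den_pos _

theorem den_dvd_commonDen (i : Fin I.n) (v : Fin I.m) : (I.util i v).den ∣ commonDen I := by
  rw [← (getD_utilWord I i v).2]
  exact Finset.dvd_prod_of_mem (fun j => (utilWord I).getD (2 * j + 1) 0)
    (Finset.mem_range.2 (grid_lt i.2 v.2))

theorem cast_weight (i : Fin I.n) (v : Fin I.m) :
    (weight I i v : ℚ) = commonDen I * I.n * I.util i v := by
  have h₁ : ((I.util i v).num.toNat : ℚ) = (I.util i v).num := by
    have : ((I.util i v).num.toNat : ℤ) = (I.util i v).num :=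
      Int.toNat_of_nonneg (Rat.num_nonneg.2 (I.util_nonneg i v))
    exact_mod_cast congrArg (Int.cast : ℤ → ℚ) this
  have h₂ : ((I.util i v).den : ℚ) ≠ 0 := by exact_mod_cast (I.util i v).den_ne_zero
  rw [weight, dif_pos i.2]
  simp only [Fin.eta]
  rw [Nat.cast_mul, Nat.cast_mul, Nat.cast_div (den_dvd_commonDen I i v) h₂, h₁]
  conv_rhs => rw [← Rat.num_div_den (I.util i v)]
  field_simp

/-- Both sides of the inequality are multiplied by the positive number `I.n * commonDen I`. The
existence of the player `i` guarantees `I.n ≠ 0`. -/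
theorem proportional_iff (i : Fin I.n) (X : Finset (Fin I.m)) :
    (1 : ℚ) / I.n ≤ I.bundleUtil i X ↔ commonDen I ≤ ∑ v ∈ X, weight I i v := by
  have hn : (0 : ℚ) < I.n := by exact_mod_cast i.pos
  have hD : (0 : ℚ) < commonDen I := by exact_mod_cast commonDen_pos I
  rw [← Nat.cast_le (α := ℚ), Nat.cast_sum]
  simp only [cast_weight]
  rw [← Finset.mul_sum, div_le_iff₀ hn, mul_assoc]
  change _ ↔ _ ≤ _ * (_ * I.bundleUtil i X)
  rw [le_mul_iff_one_le_right hD, mul_comm]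

theorem hasPropAllocation_iff : I.HasPropAllocation ↔
    Serves I.graph (weight I) (commonDen I) Finset.univ (Finset.range I.n) := by
  constructor
  · rintro ⟨π, ⟨hconn, hdisj⟩, hprop⟩
    refine ⟨fun j => if h : j < I.n then π ⟨j, h⟩ else ∅, ?_, ?_⟩
    · intro j hj
      rw [Finset.mem_range] at hj
      simp only [hj, dif_pos]
      exact ⟨Finset.subset_univ _, hconn ⟨j, hj⟩,
        (proportional_iff I ⟨j, hj⟩ _).1 (hprop ⟨j, hj⟩)⟩
    · intro j hj l hl hjl
      rw [Finset.mem_range] at hj hl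
      simp only [hj, hl, dif_pos]
      exact hdisj _ _ (by simpa using hjl)
  · rintro ⟨π, h₁, h₂⟩
    refine ⟨fun i => π i, ⟨fun i => (h₁ i (by simp)).2.1, fun i j hij => ?_⟩, fun i => ?_⟩
    · exact h₂ i (by simp) j (by simp) fun h => hij (Fin.ext h)
    · exact (proportional_iff I i _).2 (h₁ i (by simp)).2.2

/-! ### Fixed-parameter tractability -/

theorem spec_solver {M : ℕ} (hG : I.graph.IsTree) (hM : Enough M I.n I.m)
    (hsize : inputSize I.encode ≤ M) :
    solver.Spec M (.initial I.encode) fun t =>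
      (I.HasPropAllocation → t.v 0 = 1) ∧ (¬ I.HasPropAllocation → t.v 0 = 0) := by
  classical
  have hle := hM.le
  have hsz : ∀ j, (I.encode.getD j 0).size ≤ M :=
    fun j => (size_getD_le_inputSize _ _).trans hsize
  rw [encode_eq] at hsz ⊢
  have hsz₂ : ∀ j, ((matrixWord I ++ utilWord I).getD j 0).size ≤ M := fun j => by
    simpa using hsz (j + 2)
  have hmat : ∀ j < I.m * I.m,
      (matrixWord I ++ utilWord I).getD j 0 = (matrixWord I).getD j 0 := by
    intro j hj
    rw [List.getD_append _ _ _ _ (by rwa [length_matrixWord])]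
  have hdrop : (matrixWord I ++ utilWord I).drop (I.m * I.m) = utilWord I := by
    rw [← length_matrixWord, List.drop_left]
  have hsz₃ : ∀ j, ((utilWord I).getD j 0).size ≤ M := by
    intro j
    have := hsz₂ (I.m * I.m + j)
    rwa [List.getD_append_right _ _ _ _ (by rw [length_matrixWord]; omega), length_matrixWord,
      Nat.add_sub_cancel_left] at this
  refine spec_seq (spec_read (by simpa [Env.initial] using hsz 0) ?_)
  refine spec_seq (spec_read (by simpa [Env.initial] using hsz 1) ?_)
  refine spec_seq ((spec_readGraph (m := I.m) (by simp [Env.initial]) hle.2.2.2.1 hM.items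
    (by simpa [Env.initial] using hsz₂) (by simp [Env.initial])).mono ?_)
  rintro t ⟨h₁, h₂, h₃, h₄⟩
  simp only [Env.pop_inp, Env.initial, List.tail_cons] at h₁ h₃
  rw [hdrop] at h₁
  refine spec_seq (spec_assign trivial ?_)
  refine spec_seq ((spec_readUtils (n := I.n) (m := I.m) ?_ ?_ (by simp [Ex.eval])
    hle.2.2.2.1 hle.2.2.2.2.2 (by simpa [h₁] using hsz₃) (by simpa using h₄)).mono ?_)
  · simp [h₂, Env.initial]
  · simp [h₂, Env.initial]
  rintro u ⟨k₁, k₂, k₃, k₄, k₅⟩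
  simp only [Env.setv_inp, h₁, Env.setv_a] at k₂ k₃ k₄
  rw [hasPropAllocation_iff]
  refine spec_main hG (fun v => ?_) (commonDen_pos I) hM ?_ ?_ k₂ ?_ ?_ k₅ ?_
  · simp [weight]
  · simp [k₁, h₂, Env.initial]
  · simp [k₁, h₂, Env.initial]
  · intro v w hvw
    rw [k₃, h₃ _ (grid_lt v.2 w.2), hmat _ (grid_lt v.2 w.2), getD_matrixWord, if_pos hvw]
  · intro v w hvw
    rw [k₃, h₃ _ (grid_lt v.2 w.2), hmat _ (grid_lt v.2 w.2), getD_matrixWord, if_neg hvw]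
  · intro i hi v
    rw [(k₄ _ (grid_lt hi v.2)).1, (k₄ _ (grid_lt hi v.2)).2, (getD_utilWord I ⟨i, hi⟩ v).1,
      (getD_utilWord I ⟨i, hi⟩ v).2, weight, dif_pos hi]

open Polynomial in
/-- Polynomials with natural coefficients grow at most by a power under scaling. -/
theorem eval_mul_le (p : ℕ[X]) {x : ℕ} (hx : 1 ≤ x) (y : ℕ) :
    p.eval (x * y) ≤ x ^ p.natDegree * p.eval y := by
  rw [eval_eq_sum_range, eval_eq_sum_range, Finset.mul_sum]
  refine Finset.sum_le_sum fun i hi => ?_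
  rw [mul_pow, ← mul_assoc, mul_comm (p.coeff i), mul_assoc]
  exact Nat.mul_le_mul_right _ (Nat.pow_le_pow_right hx (by simpa [Nat.lt_succ_iff] using hi))

/-- The adjacency matrix is part of the input, so `m * m` is at most its size, and `n + 1 ≤ 2 ^ n`.
The factor depending on `n` is thus at most `(2 ^ n) ^ 2`. A tree has a vertex, which gives `m ≤ m *
m`. -/
theorem enough (hG : I.graph.IsTree) :
    Enough ((2 ^ I.n) ^ 2 * (inputSize I.encode + 2) ^ 2) I.n I.m := by
  have hm : I.m * I.m ≤ inputSize I.encode := by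
    refine le_trans ?_ (length_le_inputSize _)
    rw [encode_eq]
    simp [length_matrixWord]
    omega
  obtain ⟨v₀⟩ := hG.connected.nonempty
  have hm0 : 0 < I.m := v₀.pos
  have hn : I.n + 1 ≤ 2 ^ I.n := Nat.lt_two_pow_self
  set L := inputSize I.encode
  set P := 2 ^ I.n
  have hP : 1 ≤ P := Nat.one_le_two_pow
  have hL : L + 2 ≤ (L + 2) ^ 2 := by nlinarith
  have hP2 : 1 ≤ P ^ 2 := Nat.one_le_pow _ _ hP
  have hmL : I.m ≤ L := by nlinarith
  refine ⟨by nlinarith, ?_, by nlinarith, ?_⟩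
  · calc P * (I.n + 1) ≤ P * P := by gcongr
      _ = P ^ 2 * 1 := by ring
      _ ≤ P ^ 2 * (L + 2) ^ 2 := by gcongr; omega
  · calc I.m * P * (I.n + 1) ≤ (L + 2) * P * P := by gcongr; omega
      _ = P ^ 2 * (L + 2) := by ring
      _ ≤ P ^ 2 * (L + 2) ^ 2 := by gcongr

end TreeSolver

open Polynomial in
/-- Prop-CFD on trees is fixed-parameter tractable with respect to the number of players. -/
theorem mainTheorem10 :
    RAM.IsFPT (fun I : CFD => I.graph.IsTree) CFD.encode (fun I => I.n)
      CFD.HasPropAllocation := by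
  -- The time bound of `Stmt.exec_compile` as a polynomial in `M`; the size of the program text is a
  -- constant, the same for all instances.
  set R : ℕ[X] := 6 * TreeSolver.solver.charge *
    (C (TreeSolver.solver.compile 0).statics + TreeSolver.solver.charge + 1) with hR
  refine ⟨TreeSolver.solver.compile 0, fun n => ((2 ^ n) ^ 2) ^ R.natDegree,
    R.comp ((X + 2) ^ 2), fun I hI => ?_⟩
  have hM := TreeSolver.enough I hI
  have hP : 1 ≤ (2 ^ I.n) ^ 2 := Nat.one_le_pow _ _ Nat.one_le_two_pow
  have hsize : RAM.inputSize I.encode ≤ (2 ^ I.n) ^ 2 * (RAM.inputSize I.encode + 2) ^ 2 := by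
    nlinarith
  obtain ⟨hok, hyes, hno⟩ := TreeSolver.spec_solver I hI hM hsize
  obtain ⟨t, σ, hexec, ht, hσ⟩ := TreeSolver.solver.exec_compile _ _ hok
  refine ⟨t, σ, hexec, ?_, fun h => hσ.trans (hyes h), fun h => hσ.trans (hno h)⟩
  -- Here `M` is `(2 ^ n) ^ 2` times a polynomial in the input size. The first factor leaves `R` as
  -- a power with fixed exponent `R.natDegree`, which separates the parameter from the polynomial.
  have h := TreeSolver.eval_mul_le R hP ((RAM.inputSize I.encode + 2) ^ 2)
  simp only [eval_comp, eval_pow, eval_add, eval_X, eval_ofNat]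
  refine le_trans (le_of_le_of_eq ht ?_) h
  simp [hR]
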